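/- Identify $\mathbb S^d$ with the Euclidean unit sphere of $\mathbb R^{d+1}$ (coordinates $x_0,\dots,x_d$) and let $\mathcal S=\{x\in\mathbb S^d : -x_0^2+x_1^2+\dots+x_d^2=0,\ x_0\ge 0\}$. A spherical polytope in $\mathbb S^d$ is a set $\mathcal K\cap\mathbb S^d$ with $\mathcal K\subset\mathbb R^{d+1}$ a finitely generated convex cone containing no line; its faces are its intersections with supporting linear hyperplanes (together with $\emptyset$ and the polytope itself). It is $k$-scribed if every $k$-dimensional face $F$ is tangent to $\mathcal S$, that is, $\operatorname{relint}(F)\cap\mathcal S$ is a single point. A $d$-polytope is $k$-scribable if there is a $k$-scribed spherical polytope in $\mathbb S^d$ whose face lattice is isomorphic to that of the given polytope. A cyclic $d$-polytope with $n$ vertices ($n\ge d+1$) is a polytope whose face lattice is isomorphic to that of the convex hull of $n$ distinct points on the moment curve $t\mapsto(t,t^2,\dots,t^d)$. **Theorem.** For all integers $d>3$ and $1\le k\le d-1$ there is an $N$ such that, for every $n\ge N$, no cyclic $d$-polytope with $n$ vertices is $k$-scribable. -/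

import Mathlib

open Set Topology

noncomputable section

/-! ### Euclidean polytopes and cyclic polytopes -/

/-- A (bounded) convex polytope in Euclidean space: the convex hull of finitely many points. -/
def IsPolytope {d : ℕ} (P : Set (EuclideanSpace ℝ (Fin d))) : Prop :=
  ∃ V : Finset (EuclideanSpace ℝ (Fin d)), P = convexHull ℝ (V : Set (EuclideanSpace ℝ (Fin d)))

/-- The faces of a Euclidean polytope `P` (including `∅` and `P`), i.e. its exposed subsets.
Coerced to a type and ordered by inclusion, this is the face lattice of `P`. -/
def euclideanFaces {d : ℕ} (P : Set (EuclideanSpace ℝ (Fin d))) :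
    Set (Set (EuclideanSpace ℝ (Fin d))) :=
  {F | IsExposed ℝ P F}

/-- The moment curve `t ↦ (t, t², …, t^d)`. -/
def momentCurve (d : ℕ) (t : ℝ) : EuclideanSpace ℝ (Fin d) :=
  WithLp.toLp 2 fun i : Fin d => t ^ ((i : ℕ) + 1)

/-- `P` is a cyclic `d`-polytope with `n` vertices: a polytope combinatorially equivalent to the
convex hull of `n ≥ d + 1` points on the moment curve, with parameters `t₁ < ⋯ < tₙ`. -/
def IsCyclicPolytope (d n : ℕ) (P : Set (EuclideanSpace ℝ (Fin d))) : Prop :=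
  IsPolytope P ∧ d + 1 ≤ n ∧
    ∃ t : Fin n → ℝ, StrictMono t ∧
      Nonempty (euclideanFaces P ≃o
        euclideanFaces (convexHull ℝ (range fun i => momentCurve d (t i))))

/-! ### Spherical polytopes -/

/-- The space `ℝ^{d+1}`, with coordinates `x₀, x₁, …, x_d`. -/
abbrev LSpace (d : ℕ) : Type := EuclideanSpace ℝ (Fin (d + 1))

/-- The Lorentzian scalar product `-x₀ y₀ + x₁ y₁ + ⋯ + x_d y_d`. -/
def lorentzProd {d : ℕ} (x y : LSpace d) : ℝ :=
  -(x 0 * y 0) + ∑ i : Fin d, x i.succ * y i.succ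

/-- The `(d-1)`-sphere `𝒮` in the unit sphere `𝕊^d`: the boundary in `𝕊^d` of the spherical cap
cut out by the light cone `{x | ⟨x, x⟩ ≤ 0, x₀ ≥ 0}`. In the affine chart `x₀ = 1` it is the
standard unit sphere of Euclidean space. -/
def tangencySphere (d : ℕ) : Set (LSpace d) :=
  {x | x ∈ Metric.sphere (0 : LSpace d) 1 ∧ lorentzProd x x = 0 ∧ 0 ≤ x 0}

/-- A spherical polytope in `𝕊^d`, given by the pointed polyhedral cone in `ℝ^{d+1}` that it
spans. -/
structure SphericalPolytope (d : ℕ) where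
  /-- the cone over the polytope -/
  cone : PointedCone ℝ (LSpace d)
  /-- the cone is polyhedral, i.e. the conical hull of finitely many vectors -/
  polyhedral : ∃ V : Finset (LSpace d), cone = PointedCone.hull ℝ (V : Set (LSpace d))
  /-- the cone contains no line -/
  pointed : ∀ x ∈ cone, x ≠ 0 → -x ∉ cone

namespace SphericalPolytope

variable {d : ℕ}

/-- The points of the spherical polytope: the intersection of the cone with `𝕊^d`. -/
def carrier (Q : SphericalPolytope d) : Set (LSpace d) :=
  (Q.cone : Set (LSpace d)) ∩ Metric.sphere 0 1

/-- The faces of a spherical polytope `Q`: intersections of `Q` with linear hyperplanes having `Q`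
on one side. The zero functional gives the face `Q` itself, and functionals that are negative
on `Q` give the empty face. Ordered by inclusion, this is the face lattice of `Q`. -/
def faces (Q : SphericalPolytope d) : Set (Set (LSpace d)) :=
  {F | ∃ f : LSpace d →ₗ[ℝ] ℝ, (∀ x ∈ Q.carrier, f x ≤ 0) ∧ F = {x ∈ Q.carrier | f x = 0}}

end SphericalPolytope

/-- The relative interior of a subset `F` of `𝕊^d`: its interior relative to its spherical span,
the great sphere `span F ∩ 𝕊^d`. -/
def sphericalRelint {d : ℕ} (F : Set (LSpace d)) : Set (LSpace d) :=
  {x ∈ F | F ∈ 𝓝[(Submodule.span ℝ F : Set (LSpace d)) ∩ Metric.sphere 0 1] x}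

/-- A face `F` is tangent to `𝒮` if its relative interior meets `𝒮` in a single point. -/
def IsTangentFace {d : ℕ} (F : Set (LSpace d)) : Prop :=
  ∃ t, sphericalRelint F ∩ tangencySphere d = {t}

/-- `Q` is (strongly) `k`-scribed: every `k`-dimensional face of `Q` is tangent to `𝒮`. A face of
a spherical polytope is `k`-dimensional if its linear span has dimension `k + 1`. -/
def SphericalPolytope.IsScribed {d : ℕ} (Q : SphericalPolytope d) (k : ℕ) : Prop :=
  ∀ F ∈ Q.faces, Module.finrank ℝ (Submodule.span ℝ F) = k + 1 → IsTangentFace F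

/-- The (combinatorial type of the) `d`-polytope `P` is (strongly) `k`-scribable: it has a
realization as a `k`-scribed spherical polytope in `𝕊^d`. -/
def IsScribable {d : ℕ} (k : ℕ) (P : Set (EuclideanSpace ℝ (Fin d))) : Prop :=
  ∃ Q : SphericalPolytope d, Nonempty (euclideanFaces P ≃o Q.faces) ∧ Q.IsScribed k

end

/-!
The cone over `𝕊^d` lives in Minkowski space, and `𝒮` is its set of lightlike future directions.
Let `Q` be a `k`-scribed realization of a cyclic polytope with many vertices.

*Combinatorics.* Nonnegative polynomials with prescribed zeros (Gale's evenness condition) give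
enough of the face lattice: all subsets of a union of `⌊d/2⌋` pairs of consecutive vertices,
together with the first vertex if `d` is odd, are faces. The isomorphism carries them to simplicial
faces of `Q` (`nonempty_faceModel`, `finrank_span_face`).

*Tangent edges, `k = 1`.* For `d ≥ 4` any two of the vertices used are joined by an edge. If all these
edges meet `𝒮` once, then all but two of them are spacelike
and, after scaling, have mutual products `-1`, which makes them linearly independent
(`card_le_of_tangent_edges`).

*Higher faces, even `d`.* For `k ≥ 2` the span of a tangent face contains no timelike vector, and
its only lightlike direction is in the relative interior (`lform_nonneg_of_tangent`,
`eq_zero_of_lform_eq_zero`). So the caps of `𝒮` seen from two vertices always meet, and boundedly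
many points of `𝒮` pierce all caps (`exists_piercing`); each such point defines a causal vector `x`
with `form x v ≥ 0` for the vertices `v` whose caps it pierces. By the pigeonhole principle there
are many pairs of consecutive vertices whose first members are pierced by the same point, given by `x`.
Only few of the second members are on the same side `form x · ≥ 0`, for otherwise a facet would lie
on this side and not reach `𝒮` except in the direction of `x` (`card_lt_of_common_future`). So the
hyperplane `form x · = 0` separates the two members of many pairs. But it would meet the edges that
these pairs span in too many points of a `d/2`-neighbourly family, against Radon's theorem
(`not_separated_of_faces`).

*Higher faces, odd `d`.* The first vertex is spacelike. Projecting along it, onto a Minkowski space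
of one dimension less (`exists_projection`), reduces to the same configuration (`exists_bound_pairs`).
-/

noncomputable section

/-! ### Minkowski space -/

namespace Minkowski

variable {E : Type*} [NormedAddCommGroup E] [InnerProductSpace ℝ E]

/-- The Lorentzian scalar product on `ℝ × E`; the first coordinate is the time coordinate. -/
def form (E : Type*) [NormedAddCommGroup E] [InnerProductSpace ℝ E] :
    LinearMap.BilinForm ℝ (ℝ × E) :=
  LinearMap.mk₂ ℝ (fun x y => inner ℝ x.2 y.2 - x.1 * y.1)
    (by intro x y z; simp [inner_add_left]; ring)
    (by intro c x y; simp [real_inner_smul_left]; ring)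
    (by intro x y z; simp [inner_add_right]; ring)
    (by intro c x y; simp [real_inner_smul_right]; ring)

lemma form_apply (x y : ℝ × E) : form E x y = inner ℝ x.2 y.2 - x.1 * y.1 := rfl

lemma form_self (x : ℝ × E) : form E x x = ‖x.2‖ ^ 2 - x.1 ^ 2 := by
  rw [form_apply, real_inner_self_eq_norm_sq]; ring

lemma form_comm (x y : ℝ × E) : form E x y = form E y x := by
  rw [form_apply, form_apply, real_inner_comm, mul_comm]

lemma form_add_self (x y : ℝ × E) :
    form E (x + y) (x + y) = form E x x + 2 * form E x y + form E y y := by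
  simp only [map_add, LinearMap.add_apply]
  rw [form_comm y x]; ring

lemma form_smul_self (c : ℝ) (x : ℝ × E) : form E (c • x) (c • x) = c ^ 2 * form E x x := by
  simp only [map_smul, LinearMap.smul_apply, smul_eq_mul]; ring

/-- A causal vector (`form x x ≤ 0`) pointing strictly to the future. -/
def IsFuture (x : ℝ × E) : Prop := form E x x ≤ 0 ∧ 0 < x.1

lemma IsFuture.norm_le {x : ℝ × E} (hx : IsFuture x) : ‖x.2‖ ≤ x.1 := by
  have h := hx.1
  rw [form_self] at h
  exact (abs_le.1 (abs_le_of_sq_le_sq (by linarith) hx.2.le)).2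

lemma IsFuture.form_nonpos {x y : ℝ × E} (hx : IsFuture x) (hy : IsFuture y) :
    form E x y ≤ 0 := by
  have h1 := real_inner_le_norm x.2 y.2
  have h2 := mul_le_mul hx.norm_le hy.norm_le (norm_nonneg _) hx.2.le
  rw [form_apply]; linarith

/-- Two future causal vectors are orthogonal only if they are parallel (and lightlike). -/
lemma IsFuture.parallel {x y : ℝ × E} (hx : IsFuture x) (hy : IsFuture y)
    (h : 0 ≤ form E x y) : y.1 • x = x.1 • y := by
  have hx2 := hx.1
  have hy2 := hy.1
  rw [form_self] at hx2 hy2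
  rw [form_apply] at h
  have key : ‖y.1 • x.2 - x.1 • y.2‖ ^ 2 ≤ 0 := by
    rw [norm_sub_sq_real, norm_smul, norm_smul, real_inner_smul_left, real_inner_smul_right,
      Real.norm_of_nonneg hx.2.le, Real.norm_of_nonneg hy.2.le]
    have h1 := mul_le_mul_of_nonneg_left hx2 (sq_nonneg y.1)
    have h2 := mul_le_mul_of_nonneg_left hy2 (sq_nonneg x.1)
    have h3 := mul_nonneg (mul_pos hx.2 hy.2).le h
    nlinarith
  have key2 : y.1 • x.2 - x.1 • y.2 = 0 := by
    rw [← norm_eq_zero]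
    exact pow_eq_zero_iff two_ne_zero |>.1 (le_antisymm key (sq_nonneg _))
  ext
  · simp [mul_comm]
  · exact sub_eq_zero.1 key2

lemma IsFuture.form_timelike_neg {x y : ℝ × E} (hx : IsFuture x) (hy : form E y y < 0)
    (hy1 : 0 < y.1) : form E x y < 0 := by
  by_contra h
  have hp := hx.parallel ⟨hy.le, hy1⟩ (not_lt.1 h)
  -- `x` is then a positive multiple of `y`, which makes the product negative
  have h2 : form E (y.1 • x) y = x.1 * form E y y := by
    rw [hp]; simp
  rw [map_smul, LinearMap.smul_apply, smul_eq_mul] at h2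
  nlinarith [mul_nonneg hy1.le (not_lt.1 h), mul_neg_of_pos_of_neg hx.2 hy]

lemma eq_zero_of_fst_eq_zero {x : ℝ × E} (hx : form E x x ≤ 0) (h0 : x.1 = 0) : x = 0 := by
  rw [form_self, h0] at hx
  refine Prod.ext h0 ?_
  rw [Prod.snd_zero, ← norm_eq_zero]
  exact pow_eq_zero_iff two_ne_zero |>.1 (le_antisymm (by linarith) (sq_nonneg _))

/-- A causal vector whose product with a future vector is negative is itself future. -/
lemma isFuture_of_form_neg {x y : ℝ × E} (hx : form E x x ≤ 0) (hy : IsFuture y)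
    (h : form E x y < 0) : IsFuture x := by
  refine ⟨hx, ?_⟩
  by_contra h0
  rcases (not_lt.1 h0).lt_or_eq with h0 | h0
  · have hneg : IsFuture (-x) := ⟨by simpa using hx, by simpa using h0⟩
    have := hneg.form_nonpos hy
    simp at this
    linarith
  · rw [eq_zero_of_fst_eq_zero hx h0] at h
    simp at h

/-- The form on the orthogonal complement of a lightlike vector is a square, up to the
factor `t.1 ^ 2`. -/
lemma sq_mul_form_self_of_orthogonal {t y : ℝ × E} (ht : form E t t = 0) (h : form E t y = 0) :
    t.1 ^ 2 * form E y y = ‖t.1 • y.2 - y.1 • t.2‖ ^ 2 := by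
  rw [norm_sub_sq_real, norm_smul, norm_smul, real_inner_smul_left, real_inner_smul_right,
    form_self, mul_pow, mul_pow, Real.norm_eq_abs, Real.norm_eq_abs, sq_abs, sq_abs]
  rw [form_self] at ht
  rw [form_apply, real_inner_comm] at h
  linear_combination (- y.1 ^ 2) * ht + 2 * t.1 * y.1 * h

lemma form_self_nonneg_of_orthogonal {t y : ℝ × E} (ht : form E t t = 0) (ht1 : 0 < t.1)
    (h : form E t y = 0) : 0 ≤ form E y y := by
  have h1 := sq_mul_form_self_of_orthogonal ht h
  have h2 := sq_nonneg ‖t.1 • y.2 - y.1 • t.2‖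
  rw [← h1] at h2
  exact nonneg_of_mul_nonneg_right h2 (by positivity)

lemma parallel_of_orthogonal {t y : ℝ × E} (ht : form E t t = 0)
    (h : form E t y = 0) (hy : form E y y = 0) : t.1 • y = y.1 • t := by
  have h1 := sq_mul_form_self_of_orthogonal ht h
  rw [hy, mul_zero, eq_comm, pow_eq_zero_iff two_ne_zero, norm_eq_zero, sub_eq_zero] at h1
  ext
  · simp [mul_comm]
  · exact h1

/-! ### Piercing vectors that span no timelike direction in pairs -/

/-- A unit vector orthogonal to `u` in the direction of the projection of `w`; if this projection
vanishes, any unit vector orthogonal to `u` will do. -/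
lemma exists_unit_orthogonal [FiniteDimensional ℝ E] (hE : 2 ≤ Module.finrank ℝ E) (u w : E) :
    ∃ z : E, ‖z‖ = 1 ∧ inner ℝ z u = 0 ∧
      inner ℝ z w ^ 2 * ‖u‖ ^ 2 = ‖w‖ ^ 2 * ‖u‖ ^ 2 - inner ℝ u w ^ 2 ∧ 0 ≤ inner ℝ z w := by
  by_cases hp : ‖u‖ ^ 2 • w - (inner ℝ u w : ℝ) • u = 0
  · obtain ⟨z, hz, hz0⟩ : ∃ z ∈ (ℝ ∙ u)ᗮ, z ≠ 0 := by
      apply Submodule.exists_mem_ne_zero_of_ne_bot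
      intro hbot
      have h1 := Submodule.finrank_add_finrank_orthogonal (ℝ ∙ u)
      rw [hbot, finrank_bot] at h1
      have h2 := finrank_span_le_card (R := ℝ) ({u} : Set E)
      simp only [toFinset_singleton, Finset.card_singleton] at h2
      omega
    rw [Submodule.mem_orthogonal_singleton_iff_inner_left] at hz
    have hzw : ‖u‖ ^ 2 * inner ℝ z w = 0 := by
      have := congrArg (inner ℝ z) hp
      simpa [inner_sub_right, real_inner_smul_right, hz] using this
    have hpw := congrArg (inner ℝ w) hp
    simp only [inner_sub_right, real_inner_smul_right, inner_zero_right,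
      real_inner_self_eq_norm_sq, real_inner_comm u w] at hpw
    have hnz : ‖z‖ ≠ 0 := norm_ne_zero_iff.2 hz0
    by_cases hu : u = 0
    · subst hu
      rcases le_total 0 (inner ℝ z w) with h | h
      · exact ⟨‖z‖⁻¹ • z, by simp [norm_smul, hnz], by simp, by simp,
          by rw [real_inner_smul_left]; positivity⟩
      · refine ⟨-(‖z‖⁻¹ • z), by simp [norm_smul, hnz], by simp, by simp, ?_⟩
        rw [inner_neg_left, real_inner_smul_left, ← mul_neg]
        exact mul_nonneg (by positivity) (by linarith)
    · have hzw0 : inner ℝ z w = (0 : ℝ) := by simpa [hu] using hzw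
      refine ⟨‖z‖⁻¹ • z, by simp [norm_smul, hnz], by simp [real_inner_smul_left, hz], ?_, ?_⟩
      · rw [real_inner_smul_left, hzw0]; linear_combination -hpw
      · rw [real_inner_smul_left, hzw0]; simp
  · set p := ‖u‖ ^ 2 • w - (inner ℝ u w : ℝ) • u with hpdef
    have hpn : 0 < ‖p‖ := norm_pos_iff.2 hp
    have hpu : inner ℝ p u = (0 : ℝ) := by
      rw [hpdef, inner_sub_left, real_inner_smul_left, real_inner_smul_left,
        real_inner_self_eq_norm_sq, real_inner_comm]; ring
    have hpw : inner ℝ p w = ‖w‖ ^ 2 * ‖u‖ ^ 2 - (inner ℝ u w : ℝ) ^ 2 := by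
      rw [hpdef, inner_sub_left, real_inner_smul_left, real_inner_smul_left,
        real_inner_self_eq_norm_sq]; ring
    have hpp : ‖p‖ ^ 2 = ‖u‖ ^ 2 * inner ℝ p w := by
      rw [← real_inner_self_eq_norm_sq]
      conv_lhs => rw [hpdef, ← hpdef, hpdef, inner_sub_right, ← hpdef]
      rw [real_inner_smul_right, real_inner_smul_right, hpu]; ring
    refine ⟨‖p‖⁻¹ • p, by simp [norm_smul, hpn.ne'], by simp [real_inner_smul_left, hpu], ?_, ?_⟩
    · rw [← hpw, real_inner_smul_left]
      field_simp
      rw [hpp]; ring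
    · rw [real_inner_smul_left]
      have : 0 ≤ ‖u‖ ^ 2 * inner ℝ p w := by rw [← hpp]; positivity
      by_cases hu : u = 0
      · exact absurd (by simp [hpdef, hu]) hp
      · exact mul_nonneg (by positivity) (nonneg_of_mul_nonneg_right this (by positivity))

/-- If the unit spacelike vectors `v` and `w` span no timelike vector, then the sphere of
lightlike directions orthogonal to `v` has a point in the cap `form x w ≥ 0`. -/
lemma exists_lightlike_orthogonal [FiniteDimensional ℝ E] (hE : 2 ≤ Module.finrank ℝ E)
    {v w : ℝ × E} (hv : form E v v = 1) (hw : form E w w = 1) (hvw : |form E v w| ≤ 1) :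
    ∃ x : ℝ × E, form E x x = 0 ∧ 0 < x.1 ∧ form E x v = 0 ∧ 0 ≤ form E x w := by
  obtain ⟨z, hz, hzu, hzw, hzw0⟩ := exists_unit_orthogonal hE v.2 w.2
  set r := ‖v.2‖ with hr
  rw [form_self, ← hr] at hv
  rw [form_self] at hw
  have hr0 : 0 < r := by
    have : 0 < r ^ 2 := by nlinarith [sq_nonneg v.1]
    exact lt_of_le_of_ne (norm_nonneg _) (fun h => by rw [← h] at this; simp at this)
  refine ⟨(r ^ 2, v.1 • v.2 + r • z), ?_, by positivity, ?_, ?_⟩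
  · rw [form_self]
    simp only
    rw [norm_add_sq_real, norm_smul, norm_smul, real_inner_smul_left, real_inner_smul_right,
      real_inner_comm, hzu, hz, ← hr, Real.norm_eq_abs, mul_pow, sq_abs, Real.norm_of_nonneg hr0.le]
    linear_combination (-r ^ 2) * hv
  · rw [form_apply]
    simp only [inner_add_left, real_inner_smul_left, hzu, real_inner_self_eq_norm_sq, ← hr]
    ring
  · rw [form_apply] at hvw ⊢
    simp only [inner_add_left, real_inner_smul_left]
    set β : ℝ := inner ℝ v.2 w.2
    set q : ℝ := inner ℝ z w.2
    have hB : (β - v.1 * w.1) ^ 2 ≤ 1 := by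
      rw [← sq_abs]; nlinarith [abs_nonneg (β - v.1 * w.1)]
    -- it remains to compare squares; the difference is `(1 - form v w ^ 2) * r ^ 2`
    have key : (r ^ 2 * w.1 - v.1 * β) ^ 2 ≤ (r * q) ^ 2 := by
      have e1 : (r * q) ^ 2 - (r ^ 2 * w.1 - v.1 * β) ^ 2
          = (1 - (β - v.1 * w.1) ^ 2) * r ^ 2 := by
        have hr2 : r ^ 2 = 1 + v.1 ^ 2 := by linarith
        have hw2 : ‖w.2‖ ^ 2 = 1 + w.1 ^ 2 := by linarith
        have : (r * q) ^ 2 = (1 + w.1 ^ 2) * r ^ 2 - β ^ 2 := by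
          rw [← hw2, ← hzw]; ring
        rw [this, hr2]; ring
      have := mul_nonneg (sub_nonneg.2 hB) (sq_nonneg r)
      linarith
    have := (abs_le.1 (abs_le_of_sq_le_sq key (mul_nonneg hr0.le hzw0))).2
    linarith

/-- Adding a lightlike vector as in `exists_lightlike_orthogonal` raises the time coordinate of a
unit spacelike vector, which shrinks its cap, while the cap still meets that of `w`. -/
lemma exists_raise [FiniteDimensional ℝ E] (hE : 2 ≤ Module.finrank ℝ E)
    {v w : ℝ × E} (hv : form E v v = 1) (hw : form E w w = 1) (hvw : |form E v w| ≤ 1)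
    (hle : v.1 ≤ w.1) :
    ∃ v' : ℝ × E, v'.1 = w.1 ∧ form E v' v' = 1 ∧ -1 ≤ form E w v' ∧
      ∀ y, IsFuture y → form E y v' ≤ form E y v := by
  obtain ⟨x, hx, hx1, hxv, hxw⟩ := exists_lightlike_orthogonal hE hv hw hvw
  have hl : 0 ≤ (w.1 - v.1) / x.1 := div_nonneg (sub_nonneg.2 hle) hx1.le
  refine ⟨v + ((w.1 - v.1) / x.1) • x, ?_, ?_, ?_, fun y hy => ?_⟩
  · simp only [Prod.fst_add, Prod.smul_fst, smul_eq_mul]; field_simp; ring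
  · rw [form_add_self, form_smul_self, hx, map_smul, smul_eq_mul, form_comm v x, hxv, hv]; ring
  · rw [map_add, map_smul, smul_eq_mul, form_comm w x, form_comm w v]
    have := (abs_le.1 hvw).1
    have := mul_nonneg hl hxw
    linarith
  · rw [map_add, map_smul, smul_eq_mul]
    have := mul_nonpos_of_nonneg_of_nonpos hl (hy.form_nonpos ⟨hx.le, hx1⟩)
    linarith

/-- Unit spacelike vectors which in pairs span no timelike vector correspond to caps that meet in
pairs. Such a family is pierced by boundedly many points: a smallest cap meets all others, and
after shrinking these to its size they lie in a bounded region, at its scale. -/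
theorem exists_piercing [FiniteDimensional ℝ E] (hE : 2 ≤ Module.finrank ℝ E) :
    ∃ T : Finset E, ∀ {ι : Type} [Fintype ι] (v : ι → ℝ × E), (∀ i, form E (v i) (v i) = 1) →
      (∀ i j, |form E (v i) (v j)| ≤ 1) →
      ∃ (c : ι → T) (x : T → ℝ × E), (∀ a, IsFuture (x a)) ∧ ∀ i, 0 ≤ form E (x (c i)) (v i) := by
  classical
  obtain ⟨T, -, hTfin, hT⟩ := (isCompact_closedBall (0 : E) 2).finite_cover_balls
    (e := 1 / 2) (by norm_num)
  refine ⟨hTfin.toFinset, fun {ι} _ v hv hvv => ?_⟩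
  rcases isEmpty_or_nonempty ι with hι | hι
  · refine ⟨fun i => hι.elim i, fun _ => (1, 0), fun _ => ⟨by simp [form_self], by simp⟩,
      fun i => hι.elim i⟩
  obtain ⟨m, hm⟩ := Finite.exists_max fun i => (v i).1
  choose v' h1 h2 h3 h4 using fun i => exists_raise hE (hv i) (hv m) (hvv i m) (hm i)
  set s := (v m).1 with hs
  have hnorm : ∀ i, ‖(v' i).2‖ ^ 2 = 1 + s ^ 2 := fun i => by
    have := h2 i
    rw [form_self, h1] at this; linarith
  have hball : ∀ i, ∃ y ∈ T, ‖(v' i).2 - (v m).2 - y‖ < 1 / 2 := by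
    intro i
    have hmem : (v' i).2 - (v m).2 ∈ Metric.closedBall (0 : E) 2 := by
      rw [mem_closedBall_zero_iff]
      have hm2 := hv m
      have h3i := h3 i
      rw [form_self, ← hs] at hm2
      rw [form_apply, h1, ← hs, real_inner_comm] at h3i
      have : ‖(v' i).2 - (v m).2‖ ^ 2 ≤ 2 ^ 2 := by
        rw [norm_sub_sq_real, hnorm]; nlinarith
      exact (abs_le.1 (abs_le_of_sq_le_sq this (by norm_num))).2
    have := hT hmem
    simp only [mem_iUnion, Metric.mem_ball, dist_eq_norm, exists_prop] at this
    exact this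
  choose c hcT hc using hball
  have hr : 0 < Real.sqrt (1 + s ^ 2) := Real.sqrt_pos.2 (by positivity)
  have hfut : ∀ i, IsFuture (Real.sqrt (1 + s ^ 2), (v' i).2) := fun i => by
    refine ⟨?_, hr⟩
    rw [form_self]
    simp only
    rw [hnorm, Real.sq_sqrt (by positivity)]; simp
  refine ⟨fun i => ⟨c i, by simpa using hcT i⟩,
    fun a => if h : ∃ i, c i = a then (Real.sqrt (1 + s ^ 2), (v' h.choose).2) else (1, 0),
    fun a => ?_, fun i => ?_⟩
  · dsimp only
    split_ifs with h
    · exact hfut _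
    · exact ⟨by simp [form_self], by simp⟩
  · have hex : ∃ j, c j = c i := ⟨i, rfl⟩
    simp only [hex, dif_pos]
    set j := hex.choose
    have hj : c j = c i := hex.choose_spec
    refine le_trans ?_ (h4 i _ (hfut j))
    rw [form_apply]
    simp only [h1]
    have hd : ‖(v' j).2 - (v' i).2‖ ≤ 1 := by
      have e : (v' j).2 - (v' i).2
          = ((v' j).2 - (v m).2 - c j) - ((v' i).2 - (v m).2 - c i) := by rw [hj]; abel
      rw [e]
      exact (norm_sub_le _ _).trans (by linarith [hc i, hc j])
    have hd2 : ‖(v' j).2 - (v' i).2‖ ^ 2 ≤ 1 := by nlinarith [norm_nonneg ((v' j).2 - (v' i).2)]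
    rw [norm_sub_sq_real, hnorm, hnorm] at hd2
    nlinarith [sq_nonneg (Real.sqrt (1 + s ^ 2) - s),
      Real.sq_sqrt (show 0 ≤ 1 + s ^ 2 by positivity)]

end Minkowski

/-! ### Neighbourly families of pairs -/

section Zigzag

variable {V : Type*} [AddCommGroup V] [Module ℝ V] {ι : Type*} [Fintype ι] [DecidableEq ι]

/-- In a linear relation between `2e + 1` vectors of which any `e` span a face, the coefficients
are nonnegative as soon as at most `e` of them are positive. -/
lemma nonneg_of_card_pos_le {e : ℕ} (hι : Fintype.card ι = 2 * e + 1) (p : ι → V)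
    (hface : ∀ J : Finset ι, J.card = e → ∃ h : V →ₗ[ℝ] ℝ,
      (∀ i ∈ J, h (p i) = 0) ∧ ∀ i ∉ J, 0 < h (p i))
    (g : ι → ℝ) (hg : ∑ i, g i • p i = 0)
    (hcard : (Finset.univ.filter fun i => 0 < g i).card ≤ e) (i : ι) : 0 ≤ g i := by
  by_contra hi
  obtain ⟨J, hPJ, hJ, hJc⟩ := Finset.exists_subsuperset_card_eq
    (s := Finset.univ.filter fun i => 0 < g i) (t := Finset.univ.erase i) (n := e)
    (by
      intro j hj
      have : j ≠ i := by rintro rfl; simp at hj; linarith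
      simpa using this)
    hcard (by rw [Finset.card_erase_of_mem (Finset.mem_univ i), Finset.card_univ, hι]; omega)
  obtain ⟨h, h0, h1⟩ := hface J hJc
  have hiJ : i ∉ J := fun hmem => by simpa using hJ hmem
  have hsum : ∑ j, g j * h (p j) = 0 := by
    have := congrArg h hg
    simpa using this
  have hle : ∀ j ∈ Finset.univ, g j * h (p j) ≤ 0 := by
    intro j _
    by_cases hj : j ∈ J
    · simp [h0 j hj]
    · refine mul_nonpos_of_nonpos_of_nonneg ?_ (h1 j hj).le
      by_contra hgj
      exact hj (hPJ (by simpa using hgj))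
  have := (Finset.sum_eq_zero_iff_of_nonpos hle).1 hsum i (Finset.mem_univ i)
  rcases mul_eq_zero.1 this with h' | h'
  · exact hi h'.ge
  · exact (h1 i hiJ).ne' h'

/-- By Radon's argument, `2e + 1` vectors of which any `e` span a face are independent. -/
lemma linearIndependent_of_faces {e : ℕ} (hι : Fintype.card ι = 2 * e + 1) (p : ι → V)
    (hface : ∀ J : Finset ι, J.card = e → ∃ h : V →ₗ[ℝ] ℝ,
      (∀ i ∈ J, h (p i) = 0) ∧ ∀ i ∉ J, 0 < h (p i)) : LinearIndependent ℝ p := by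
  rw [Fintype.linearIndependent_iff]
  -- one of the two sign classes has at most `e` elements
  have main : ∀ g : ι → ℝ, ∑ i, g i • p i = 0 →
      (Finset.univ.filter fun i => 0 < g i).card ≤ e → ∀ i, g i = 0 := by
    intro g hg hc i
    have h1 := nonneg_of_card_pos_le hι p hface g hg hc
    have h2 := nonneg_of_card_pos_le hι p hface (-g) (by simpa using hg) (by
      rw [Finset.card_eq_zero.2]
      · omega
      · ext j; simpa using h1 j) i
    have h3 := h1 i
    simp only [Pi.neg_apply] at h2
    linarith
  intro g hg
  by_cases hc : (Finset.univ.filter fun i => 0 < g i).card ≤ e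
  · exact main g hg hc
  · intro i
    have hc2 : (Finset.univ.filter fun i => 0 < (-g) i).card ≤ e := by
      have hd : Disjoint (Finset.univ.filter fun i => 0 < g i)
          (Finset.univ.filter fun i => 0 < (-g) i) := by
        rw [Finset.disjoint_filter]
        intro j _ h1 h2
        simp only [Pi.neg_apply] at h2
        linarith
      have h1 := Finset.card_le_univ ((Finset.univ.filter fun i => 0 < g i).disjUnion _ hd)
      rw [Finset.card_disjUnion, hι] at h1
      omega
    have := main (-g) (by simpa using hg) hc2 i
    simpa using this

/-- If any `e` of the pairs `v (i, false), v (i, true)` span a face, then no hyperplane separates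
the two members of each of `2e + 1` pairs: it would cut the edges spanned by the pairs in an
`e`-neighbourly family of `2e + 1` vectors in dimension `2e`. -/
lemma not_separated_of_faces {e : ℕ} (hι : Fintype.card ι = 2 * e + 1) [FiniteDimensional ℝ V]
    (hV : Module.finrank ℝ V = 2 * e + 1) (v : ι × Bool → V)
    (hface : ∀ J : Finset ι, J.card = e → ∃ h : V →ₗ[ℝ] ℝ,
      (∀ i ∈ J, ∀ b, h (v (i, b)) = 0) ∧ ∀ i ∉ J, ∀ b, 0 < h (v (i, b)))
    (f : V →ₗ[ℝ] ℝ) (hA : ∀ i, 0 ≤ f (v (i, false))) (hB : ∀ i, f (v (i, true)) < 0) : False := by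
  set p : ι → V := fun i => -f (v (i, true)) • v (i, false) + f (v (i, false)) • v (i, true)
  have hp : LinearIndependent ℝ p := by
    refine linearIndependent_of_faces hι p fun J hJ => ?_
    obtain ⟨h, h0, h1⟩ := hface J hJ
    refine ⟨h, fun i hi => ?_, fun i hi => ?_⟩
    · simp only [p, map_add, map_smul, h0 i hi, smul_zero, add_zero]
    · simp only [p, map_add, map_smul, smul_eq_mul]
      have := mul_pos (neg_pos.2 (hB i)) (h1 i hi false)
      have := mul_nonneg (hA i) (h1 i hi true).le
      linarith
  have hker : ∀ i, p i ∈ LinearMap.ker f := fun i => by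
    simp only [p, LinearMap.mem_ker, map_add, map_smul, smul_eq_mul]; ring
  have hp' : LinearIndependent ℝ fun i => (⟨p i, hker i⟩ : LinearMap.ker f) :=
    LinearIndependent.of_comp (LinearMap.ker f).subtype hp
  have h1 := hp'.fintype_card_le_finrank
  have hlt : Module.finrank ℝ (LinearMap.ker f) < Module.finrank ℝ V := by
    apply Submodule.finrank_lt
    intro htop
    have hne : Nonempty ι := Fintype.card_pos_iff.1 (by omega)
    obtain ⟨i⟩ := hne
    have : v (i, true) ∈ LinearMap.ker f := by rw [htop]; trivial
    exact (hB i).ne (LinearMap.mem_ker.1 this)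
  omega

end Zigzag

/-! ### The bound on the number of pairs -/

namespace Minkowski

variable {E : Type*} [NormedAddCommGroup E] [InnerProductSpace ℝ E]

/-- Two faces without common pair are not both on the side `form x · ≥ 0` of a causal vector `x`:
the future vectors they contain would be parallel to `x`. -/
lemma card_lt_of_common_future {ι : Type*} [DecidableEq ι] {e : ℕ} (v : ι × Bool → ℝ × E)
    (hcone : ∀ J : Finset ι, J.card = e → ∃ α : ι × Bool → ℝ, (∀ i, 0 ≤ α i) ∧
      IsFuture (∑ i ∈ J, ∑ b, α (i, b) • v (i, b)))
    (hface : ∀ J : Finset ι, J.card = e → ∃ h : ℝ × E →ₗ[ℝ] ℝ,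
      (∀ i ∈ J, ∀ b, h (v (i, b)) = 0) ∧ ∀ i ∉ J, ∀ b, 0 < h (v (i, b)))
    {x : ℝ × E} (hx : IsFuture x) (I : Finset ι) (hI : ∀ i ∈ I, ∀ b, 0 ≤ form E x (v (i, b))) :
    I.card < 2 * e := by
  by_contra hcard
  obtain ⟨J, hJI, hJ⟩ := Finset.exists_subset_card_eq (s := I) (n := e) (by omega)
  obtain ⟨J', hJI', hJ'⟩ := Finset.exists_subset_card_eq (s := I \ J) (n := e)
    (by rw [Finset.card_sdiff_of_subset hJI]; omega)
  have hpar : ∀ J : Finset ι, J ⊆ I → ∀ α : ι × Bool → ℝ, (∀ i, 0 ≤ α i) →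
      IsFuture (∑ i ∈ J, ∑ b, α (i, b) • v (i, b)) →
      (∑ i ∈ J, ∑ b, α (i, b) • v (i, b)).1 • x = x.1 • (∑ i ∈ J, ∑ b, α (i, b) • v (i, b)) := by
    intro J hJI α hα ht
    refine hx.parallel ht ?_
    rw [map_sum]
    refine Finset.sum_nonneg fun i hi => ?_
    rw [map_sum]
    refine Finset.sum_nonneg fun b _ => ?_
    rw [map_smul, smul_eq_mul]
    exact mul_nonneg (hα _) (hI i (hJI hi) b)
  obtain ⟨α, hα, ht⟩ := hcone J hJ
  obtain ⟨α', hα', ht'⟩ := hcone J' hJ'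
  obtain ⟨h, h0, h1⟩ := hface J hJ
  have e1 := congrArg h (hpar J hJI α hα ht)
  have e2 := congrArg h (hpar J' (hJI'.trans Finset.sdiff_subset) α' hα' ht')
  have hz : h (∑ i ∈ J, ∑ b, α (i, b) • v (i, b)) = 0 := by
    rw [map_sum]
    refine Finset.sum_eq_zero fun i hi => ?_
    rw [map_sum]
    exact Finset.sum_eq_zero fun b _ => by rw [map_smul, h0 i hi, smul_zero]
  rw [map_smul, map_smul, hz, smul_zero, smul_eq_mul, mul_eq_zero, or_iff_right ht.2.ne'] at e1
  rw [map_smul, map_smul, e1, smul_zero, eq_comm, smul_eq_mul, mul_eq_zero,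
    or_iff_right hx.2.ne'] at e2
  simp only [map_sum, map_smul, smul_eq_mul] at e2
  have hJ'n : ∀ i ∈ J', i ∉ J := fun i hi => (Finset.mem_sdiff.1 (hJI' hi)).2
  have hnn : ∀ i ∈ J', ∀ b, 0 ≤ α' (i, b) * h (v (i, b)) := fun i hi b =>
    mul_nonneg (hα' _) (h1 i (hJ'n i hi) b).le
  rw [Finset.sum_eq_zero_iff_of_nonneg fun i hi => Finset.sum_nonneg fun b _ => hnn i hi b] at e2
  have : (∑ i ∈ J', ∑ b, α' (i, b) • v (i, b)) = 0 := by
    refine Finset.sum_eq_zero fun i hi => Finset.sum_eq_zero fun b _ => ?_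
    have h3 := (Finset.sum_eq_zero_iff_of_nonneg fun b _ => hnn i hi b).1 (e2 i hi) b
      (Finset.mem_univ b)
    rcases mul_eq_zero.1 h3 with h4 | h4
    · rw [h4, zero_smul]
    · exact absurd h4 (h1 i (hJ'n i hi) b).ne'
  rw [this] at ht'
  exact lt_irrefl _ ht'.2

/-- A neighbourly family of pairs of spacelike vectors in dimension `2e + 1`, such that the faces
spanned by `e` pairs meet the light cone but two vectors never span a timelike one, is bounded. -/
theorem exists_bound_pairs [FiniteDimensional ℝ E] {e : ℕ} (he : 1 ≤ e)
    (hE : Module.finrank ℝ E = 2 * e) :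
    ∃ M : ℕ, e ≤ M ∧ ∀ v : Fin M × Bool → ℝ × E, (∀ p, 0 < form E (v p) (v p)) →
      (∀ p q, form E (v p) (v q) ^ 2 ≤ form E (v p) (v p) * form E (v q) (v q)) →
      (∀ J : Finset (Fin M), J.card = e → ∃ α : Fin M × Bool → ℝ, (∀ i, 0 ≤ α i) ∧
        IsFuture (∑ i ∈ J, ∑ b, α (i, b) • v (i, b))) →
      (∀ J : Finset (Fin M), J.card = e → ∃ h : ℝ × E →ₗ[ℝ] ℝ,
        (∀ i ∈ J, ∀ b, h (v (i, b)) = 0) ∧ ∀ i ∉ J, ∀ b, 0 < h (v (i, b))) → False := by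
  classical
  obtain ⟨T, hT⟩ := exists_piercing (E := E) (by omega)
  refine ⟨Fintype.card T * (4 * e) + 1 + e, by omega, fun v hpos hpsd hcone hface => ?_⟩
  obtain ⟨c, x, hx, hxc⟩ := hT (fun p => (Real.sqrt (form E (v p) (v p)))⁻¹ • v p)
    (fun p => by
      rw [form_smul_self, inv_pow, Real.sq_sqrt (hpos p).le, inv_mul_cancel₀ (hpos p).ne'])
    (fun p q => by
      rw [← sq_le_one_iff_abs_le_one]
      simp only [map_smul, LinearMap.smul_apply, smul_eq_mul]
      rw [mul_pow, mul_pow, inv_pow, inv_pow, Real.sq_sqrt (hpos p).le, Real.sq_sqrt (hpos q).le]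
      have h1 := hpos p
      have h2 := hpos q
      field_simp
      linarith [hpsd p q])
  have hxv : ∀ p, 0 ≤ form E (x (c p)) (v p) := fun p => by
    have := hxc p
    rw [map_smul, smul_eq_mul] at this
    exact nonneg_of_mul_nonneg_right this (inv_pos.2 (Real.sqrt_pos.2 (hpos p)))
  -- the first members of many pairs have the same colour
  obtain ⟨a, hab⟩ := Fintype.exists_lt_card_fiber_of_mul_lt_card
    (fun i => c (i, false)) (n := 4 * e)
    (by rw [Fintype.card_fin]; omega)
  set I := Finset.univ.filter fun i => c (i, false) = a with hI
  have hIa : ∀ i ∈ I, 0 ≤ form E (x a) (v (i, false)) := fun i hi => by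
    have := hxv (i, false)
    simp only [hI, Finset.mem_filter, Finset.mem_univ, true_and] at hi
    rwa [hi] at this
  have hplus := card_lt_of_common_future v hcone hface (hx a)
    (I.filter fun i => 0 ≤ form E (x a) (v (i, true))) (by
      intro i hi b
      rw [Finset.mem_filter] at hi
      cases b
      · exact hIa i hi.1
      · exact hi.2)
  have hsplit := Finset.card_filter_add_card_filter_not (s := I)
    (fun i => 0 ≤ form E (x a) (v (i, true)))
  obtain ⟨K, hK, hKc⟩ := Finset.exists_subset_card_eq
    (s := I.filter fun i => ¬ 0 ≤ form E (x a) (v (i, true))) (n := 2 * e + 1) (by omega)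
  refine not_separated_of_faces (ι := K) (e := e) (by simpa using hKc)
    (by rw [Module.finrank_prod, hE, Module.finrank_self]; ring) (fun p => v (p.1, p.2)) ?_
    (form E (x a)) (fun i => hIa i (Finset.mem_filter.1 (hK i.2)).1)
    (fun i => not_le.1 (Finset.mem_filter.1 (hK i.2)).2)
  intro J hJ
  obtain ⟨h, h0, h1⟩ := hface (J.map (Function.Embedding.subtype _)) (by simpa using hJ)
  refine ⟨h, fun i hi b => h0 i (by simpa using hi) b, fun i hi b => h1 i ?_ b⟩
  simpa using hi

end Minkowski

/-! ### Faces of cyclic polytopes -/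

section CyclicFaces

open Polynomial

/-- The functional that takes the value `p(0) - p(t)` at the point `momentCurve d t`. -/
def polyFunctional (d : ℕ) (p : ℝ[X]) : StrongDual ℝ (EuclideanSpace ℝ (Fin d)) :=
  -∑ i : Fin d, p.coeff (i + 1) • (EuclideanSpace.proj i : EuclideanSpace ℝ (Fin d) →L[ℝ] ℝ)

lemma polyFunctional_momentCurve {d : ℕ} {p : ℝ[X]} (hp : p.natDegree ≤ d) (t : ℝ) :
    polyFunctional d p (momentCurve d t) = p.coeff 0 - p.eval t := by
  rw [eval_eq_sum_range' (Nat.lt_succ_of_le hp), Finset.sum_range_succ']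
  simp [polyFunctional, momentCurve,
    Finset.sum_range fun i => p.coeff (i + 1) * t ^ (i + 1)]

variable {d n : ℕ}

/-- Gale's condition for the points with parameters `t i`, `i ∈ S`, to span a face: some polynomial
of degree at most `d` is nonnegative on all parameters and vanishes exactly at those in `S`. -/
def IsGaleFace (d : ℕ) (t : Fin n → ℝ) (S : Finset (Fin n)) : Prop :=
  ∃ p : ℝ[X], p.natDegree ≤ d ∧ (∀ i, 0 ≤ p.eval (t i)) ∧ ∀ i, p.eval (t i) = 0 ↔ i ∈ S

/-- The convex hull of the points on the moment curve indexed by `S`. -/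
def momentHull (d : ℕ) (t : Fin n → ℝ) (S : Finset (Fin n)) : Set (EuclideanSpace ℝ (Fin d)) :=
  convexHull ℝ ((fun i => momentCurve d (t i)) '' S)

lemma momentHull_mono (t : Fin n → ℝ) {S S' : Finset (Fin n)} (h : S ⊆ S') :
    momentHull d t S ⊆ momentHull d t S' :=
  convexHull_mono (image_mono (by exact_mod_cast h))

/-- A polynomial nonnegative on all parameters exposes the hull of the points where it vanishes. -/
lemma momentHull_eq {t : Fin n → ℝ} {S : Finset (Fin n)} {p : ℝ[X]} (hp : p.natDegree ≤ d)
    (hp0 : ∀ i, 0 ≤ p.eval (t i)) (hpS : ∀ i, p.eval (t i) = 0 ↔ i ∈ S) :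
    (∀ x ∈ convexHull ℝ (range fun i => momentCurve d (t i)),
      polyFunctional d p x ≤ p.coeff 0) ∧
    momentHull d t S = {x ∈ convexHull ℝ (range fun i => momentCurve d (t i)) |
      polyFunctional d p x = p.coeff 0} := by
  have hle : convexHull ℝ (range fun i => momentCurve d (t i)) ⊆
      {x | polyFunctional d p x ≤ p.coeff 0 ∧
        (polyFunctional d p x = p.coeff 0 → x ∈ momentHull d t S)} := by
    refine convexHull_min ?_ ?_
    · rintro _ ⟨i, rfl⟩
      simp only [mem_ofPred_eq, polyFunctional_momentCurve hp]
      refine ⟨by linarith [hp0 i], fun h => subset_convexHull _ _ ⟨i, ?_, rfl⟩⟩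
      exact (hpS i).1 (by linarith)
    · rw [convex_iff_forall_pos]
      rintro x ⟨hx1, hx2⟩ y ⟨hy1, hy2⟩ a b ha hb hab
      simp only [mem_ofPred_eq, map_add, map_smul, smul_eq_mul]
      have h1 := mul_le_mul_of_nonneg_left hx1 ha.le
      have h2 := mul_le_mul_of_nonneg_left hy1 hb.le
      have h3 : a * p.coeff 0 + b * p.coeff 0 = p.coeff 0 := by rw [← add_mul, hab, one_mul]
      refine ⟨by linarith, fun h => ?_⟩
      have e1 : a * polyFunctional d p x = a * p.coeff 0 := by linarith
      have e2 : b * polyFunctional d p y = b * p.coeff 0 := by linarith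
      exact convex_convexHull ℝ _ (hx2 (mul_left_cancel₀ ha.ne' e1))
        (hy2 (mul_left_cancel₀ hb.ne' e2)) ha.le hb.le hab
  refine ⟨fun x hx => (hle hx).1, Subset.antisymm ?_ fun x hx => (hle hx.1).2 hx.2⟩
  refine convexHull_min ?_ ?_
  · rintro _ ⟨i, hi, rfl⟩
    refine ⟨subset_convexHull _ _ ⟨i, rfl⟩, ?_⟩
    rw [polyFunctional_momentCurve hp, (hpS i).2 hi, sub_zero]
  · refine (convex_convexHull ℝ _).inter ?_
    exact convex_hyperplane (polyFunctional d p).toLinearMap.isLinear _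

lemma IsGaleFace.mem_faces {t : Fin n → ℝ} {S : Finset (Fin n)} (h : IsGaleFace d t S) :
    momentHull d t S ∈ euclideanFaces (convexHull ℝ (range fun i => momentCurve d (t i))) := by
  obtain ⟨p, hp, hp0, hpS⟩ := h
  obtain ⟨h1, h2⟩ := momentHull_eq hp hp0 hpS
  rintro ⟨z, hz⟩
  refine ⟨polyFunctional d p, ?_⟩
  rw [h2] at hz ⊢
  ext x
  refine and_congr_right fun hx => ⟨fun h y hy => (h1 y hy).trans h.ge, fun h => ?_⟩
  exact le_antisymm (h1 x hx) (hz.2 ▸ h z hz.1)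

lemma IsGaleFace.mem_momentHull {t : Fin n → ℝ} {S : Finset (Fin n)} (h : IsGaleFace d t S)
    (i : Fin n) : momentCurve d (t i) ∈ momentHull d t S ↔ i ∈ S := by
  obtain ⟨p, hp, hp0, hpS⟩ := h
  rw [(momentHull_eq hp hp0 hpS).2, mem_ofPred_eq, polyFunctional_momentCurve hp,
    sub_eq_self, hpS]
  exact and_iff_right (subset_convexHull ℝ _ ⟨i, rfl⟩)

lemma momentHull_singleton (t : Fin n → ℝ) (i : Fin n) :
    momentHull d t {i} = {momentCurve d (t i)} := by
  simp [momentHull]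

lemma isGaleFace_singleton (hd : 2 ≤ d) {t : Fin n → ℝ} (ht : StrictMono t) (i : Fin n) :
    IsGaleFace d t {i} := by
  refine ⟨(X - C (t i)) ^ 2, ?_, fun j => ?_, fun j => ?_⟩
  · rw [natDegree_pow, natDegree_X_sub_C]; omega
  · simp only [eval_pow, eval_sub, eval_X, eval_C]; positivity
  · simp [sub_eq_zero, ht.injective.eq_iff]

end CyclicFaces

/-! ### Transport of faces to the realization -/

namespace SphericalPolytope

variable {d n : ℕ} {Q : SphericalPolytope d}

lemma inter_mem_faces {F G : Set (LSpace d)} (hF : F ∈ Q.faces) (hG : G ∈ Q.faces) :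
    F ∩ G ∈ Q.faces := by
  obtain ⟨f, hf, rfl⟩ := hF
  obtain ⟨g, hg, rfl⟩ := hG
  refine ⟨f + g, fun x hx => by simpa using add_nonpos (hf x hx) (hg x hx), ?_⟩
  ext x
  simp only [mem_inter_iff, mem_ofPred_eq, LinearMap.add_apply]
  constructor
  · rintro ⟨⟨hx, h1⟩, -, h2⟩
    exact ⟨hx, by rw [h1, h2, add_zero]⟩
  · rintro ⟨hx, h⟩
    have h1 := hf x hx
    have h2 := hg x hx
    exact ⟨⟨hx, by linarith⟩, hx, by linarith⟩

/-- A partial description of the face lattice of `Q`: points `vert i` of `Q`, and for each set `S`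
of indices that is `Good` a face of `Q` containing exactly those `vert i` with `i ∈ S`. -/
structure FaceModel (Q : SphericalPolytope d) (n : ℕ) (Good : Finset (Fin n) → Prop) where
  /-- the marked points -/
  vert : Fin n → LSpace d
  /-- the face with a given set of marked points -/
  face : Finset (Fin n) → Set (LSpace d)
  vert_mem : ∀ i, vert i ∈ Q.carrier
  face_mem : ∀ S, Good S → face S ∈ Q.faces
  vert_mem_iff : ∀ S, Good S → ∀ i, vert i ∈ face S ↔ i ∈ S
  face_mono : ∀ S S', Good S → Good S' → S ⊆ S' → face S ⊆ face S'

/-- An isomorphism of face lattices carries the faces given by Gale's condition over to `Q`. -/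
theorem nonempty_faceModel (hd : 2 ≤ d) {t : Fin n → ℝ} (ht : StrictMono t)
    (Θ : euclideanFaces (convexHull ℝ (range fun i => momentCurve d (t i))) ≃o Q.faces) :
    Nonempty (FaceModel Q n (IsGaleFace d t)) := by
  classical
  have hsing := fun i => (isGaleFace_singleton hd ht i).mem_faces
  let Z : euclideanFaces (convexHull ℝ (range fun i => momentCurve d (t i))) :=
    ⟨∅, fun h => absurd h (by simp)⟩
  have hZ : ∀ i, ∃ x ∈ (Θ ⟨_, hsing i⟩ : Set (LSpace d)), x ∉ (Θ Z : Set (LSpace d)) := by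
    intro i
    by_contra! hcon
    have : Θ ⟨_, hsing i⟩ ≤ Θ Z := hcon
    rw [Θ.le_iff_le] at this
    have h2 : momentHull d t {i} ⊆ ∅ := this
    rw [momentHull_singleton] at h2
    exact h2 rfl
  choose v hv hvZ using hZ
  refine ⟨⟨v, fun S => if h : IsGaleFace d t S then Θ ⟨_, h.mem_faces⟩ else ∅, fun i => ?_,
    fun S hS => ?_, fun S hS i => ?_, fun S S' hS hS' hSS' => ?_⟩⟩
  · obtain ⟨f, hf, he⟩ := (Θ ⟨_, hsing i⟩).2
    have := hv i
    rw [he] at this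
    exact this.1
  · rw [dif_pos hS]; exact (Θ _).2
  · rw [dif_pos hS]
    have key : (⟨_, hsing i⟩ : euclideanFaces _) ≤ ⟨_, hS.mem_faces⟩ ↔ i ∈ S := by
      rw [← hS.mem_momentHull, Subtype.mk_le_mk, momentHull_singleton]
      exact singleton_subset_iff
    refine ⟨fun hmem => ?_, fun hi => ?_⟩
    · -- the intersection of the two faces corresponds to a nonempty face inside a single vertex
      let X : Q.faces := ⟨_, inter_mem_faces (Θ ⟨_, hsing i⟩).2 (Θ ⟨_, hS.mem_faces⟩).2⟩
      have hX1 : X ≤ Θ ⟨_, hsing i⟩ := inter_subset_left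
      have hX2 : X ≤ Θ ⟨_, hS.mem_faces⟩ := inter_subset_right
      have hX3 : ¬ X ≤ Θ Z := fun h => hvZ i (h ⟨hv i, hmem⟩)
      rw [← Θ.symm_apply_le] at hX1 hX2 hX3
      rw [← key]
      refine le_trans ?_ hX2
      have h1 : (Θ.symm X : Set (EuclideanSpace ℝ (Fin d))) ⊆ {momentCurve d (t i)} := by
        rw [← momentHull_singleton]; exact hX1
      rcases subset_singleton_iff_eq.1 h1 with h2 | h2
      · exact absurd (show Θ.symm X ≤ Z from h2.le) hX3
      · change momentHull d t {i} ⊆ (Θ.symm X : Set (EuclideanSpace ℝ (Fin d)))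
        rw [h2, momentHull_singleton]
    · exact (Θ.le_iff_le.2 (key.2 hi) : _) (hv i)
  · rw [dif_pos hS, dif_pos hS']
    exact Θ.le_iff_le.2 (momentHull_mono t hSS')

namespace FaceModel

variable {Good : Finset (Fin n) → Prop} (R : FaceModel Q n Good)

lemma face_subset {S : Finset (Fin n)} (hS : Good S) : R.face S ⊆ Q.carrier := by
  obtain ⟨f, -, h⟩ := R.face_mem S hS
  rw [h]; exact fun x hx => hx.1

lemma exists_functional {S : Finset (Fin n)} (hS : Good S) :
    ∃ f : LSpace d →ₗ[ℝ] ℝ, (∀ x ∈ Q.carrier, f x ≤ 0) ∧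
      (∀ x ∈ Q.carrier, x ∈ R.face S ↔ f x = 0) ∧
      (∀ i ∈ S, f (R.vert i) = 0) ∧ ∀ i ∉ S, f (R.vert i) < 0 := by
  obtain ⟨f, hf, h⟩ := R.face_mem S hS
  have h1 : ∀ x ∈ Q.carrier, x ∈ R.face S ↔ f x = 0 := fun x hx => by
    rw [h]; exact and_iff_right hx
  refine ⟨f, hf, h1, fun i hi => ?_, fun i hi => ?_⟩
  · exact (h1 _ (R.vert_mem i)).1 ((R.vert_mem_iff S hS i).2 hi)
  · refine lt_of_le_of_ne (hf _ (R.vert_mem i)) fun h0 => hi ?_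
    exact (R.vert_mem_iff S hS i).1 ((h1 _ (R.vert_mem i)).2 h0)

variable {J : Finset (Fin n)} (hJ : ∀ S ⊆ J, Good S)
include hJ

/-- If all subsets of `J` give faces, then the points indexed by `J` are independent. -/
lemma linearIndepOn : LinearIndepOn ℝ R.vert J := by
  rw [linearIndepOn_finset_iff]
  intro g hg i hi
  obtain ⟨f, -, -, h0, h1⟩ := R.exists_functional (hJ _ (Finset.erase_subset i J))
  have h2 := congrArg f hg
  rw [map_sum, map_zero, Finset.sum_eq_single_of_mem i hi, map_smul, smul_eq_mul] at h2
  · exact (mul_eq_zero.1 h2).resolve_right (h1 i (Finset.notMem_erase i J)).ne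
  · intro j hj hji
    rw [map_smul, h0 j (Finset.mem_erase.2 ⟨hji, hj⟩), smul_zero]

variable (hJd : J.card = d) {o : Fin n} (ho : o ∉ J)
include hJd ho

lemma finrank_span_face_le (m : ℕ) : ∀ S ⊆ J, S.card + m = d →
    Module.finrank ℝ (Submodule.span ℝ (R.face S)) ≤ S.card := by
  induction m with
  | zero =>
    intro S hS hc
    obtain rfl : S = J := Finset.eq_of_subset_of_card_le hS (by omega)
    obtain ⟨f, -, h0, -, h1⟩ := R.exists_functional (hJ _ subset_rfl)
    have hle : Submodule.span ℝ (R.face S) ≤ LinearMap.ker f :=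
      Submodule.span_le.2 fun x hx => (h0 x (R.face_subset (hJ _ subset_rfl) hx)).1 hx
    have hlt : Submodule.span ℝ (R.face S) < ⊤ := by
      refine lt_of_le_of_ne le_top fun htop => ?_
      rw [htop] at hle
      exact (h1 o ho).ne (hle (Submodule.mem_top : R.vert o ∈ ⊤))
    have := Submodule.finrank_lt hlt.ne
    rw [finrank_euclideanSpace_fin] at this
    omega
  | succ m ih =>
    intro S hS hc
    obtain ⟨i, hi, hiS⟩ := Finset.exists_mem_notMem_of_card_lt_card (s := S) (t := J) (by omega)
    have hS' : insert i S ⊆ J := Finset.insert_subset hi hS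
    have h2 := ih _ hS' (by rw [Finset.card_insert_of_notMem hiS]; omega)
    rw [Finset.card_insert_of_notMem hiS] at h2
    obtain ⟨f, -, h0, -, h1⟩ := R.exists_functional (hJ _ hS)
    have hlt : Submodule.span ℝ (R.face S) < Submodule.span ℝ (R.face (insert i S)) := by
      refine lt_of_le_of_ne (Submodule.span_mono
        (R.face_mono _ _ (hJ _ hS) (hJ _ hS') (Finset.subset_insert _ _))) fun he => ?_
      have hle : Submodule.span ℝ (R.face S) ≤ LinearMap.ker f :=
        Submodule.span_le.2 fun x hx => (h0 x (R.face_subset (hJ _ hS) hx)).1 hx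
      rw [he] at hle
      refine (h1 i hiS).ne (hle (Submodule.subset_span ?_))
      exact (R.vert_mem_iff _ (hJ _ hS') i).2 (Finset.mem_insert_self _ _)
    have := Submodule.finrank_lt_finrank_of_lt hlt
    omega

/-- If all subsets of a set `J` of `d` indices give faces, then these faces are simplices. -/
lemma finrank_span_face {S : Finset (Fin n)} (hS : S ⊆ J) :
    Module.finrank ℝ (Submodule.span ℝ (R.face S)) = S.card ∧
      Submodule.span ℝ (R.face S) = Submodule.span ℝ (R.vert '' S) := by
  have h1 := R.finrank_span_face_le hJ hJd ho (d - S.card) S hS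
    (by have := Finset.card_le_card hS; omega)
  have hli : LinearIndepOn ℝ R.vert S :=
    (R.linearIndepOn hJ).mono (by exact_mod_cast hS)
  have h2 : Module.finrank ℝ (Submodule.span ℝ (R.vert '' S)) = S.card := by
    have := finrank_span_eq_card (R := ℝ) hli
    rw [Set.image_eq_range]
    simpa using this
  have hle : Submodule.span ℝ (R.vert '' S) ≤ Submodule.span ℝ (R.face S) := by
    refine Submodule.span_mono ?_
    rintro _ ⟨i, hi, rfl⟩
    exact (R.vert_mem_iff S (hJ S hS) i).2 hi
  have h3 := Submodule.finrank_mono hle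
  exact ⟨by omega, (Submodule.eq_of_le_of_finrank_le hle (by omega)).symm⟩

lemma exists_coeff {S : Finset (Fin n)} (hS : S ⊆ J) {x : LSpace d} (hx : x ∈ R.face S) :
    ∃ c : Fin n → ℝ, (∀ i ∈ S, 0 ≤ c i) ∧ x = ∑ i ∈ S, c i • R.vert i := by
  have h1 : x ∈ Submodule.span ℝ (R.vert '' S) := by
    rw [← (R.finrank_span_face hJ hJd ho hS).2]; exact Submodule.subset_span hx
  obtain ⟨c, hc⟩ := (Submodule.mem_span_image_finset_iff_exists_fun' ℝ).1 h1
  refine ⟨c, fun i hi => ?_, hc.symm⟩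
  obtain ⟨f, hf, -, h0, h1⟩ := R.exists_functional
    (hJ _ ((Finset.erase_subset i S).trans hS))
  have h2 := hf x (R.face_subset (hJ S hS) hx)
  rw [← hc, map_sum, Finset.sum_eq_single_of_mem i hi, map_smul, smul_eq_mul] at h2
  · exact nonneg_of_mul_nonpos_left h2 (h1 i (Finset.notMem_erase i S))
  · intro j hj hji
    rw [map_smul, h0 j (Finset.mem_erase.2 ⟨hji, hj⟩), smul_zero]

end FaceModel

end SphericalPolytope

/-! ### Tangent faces -/

open Minkowski Filter

section Tangent

variable {d : ℕ}

/-- Splitting off the coordinate `x₀` as time coordinate. -/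
def toMinkowski (d : ℕ) : LSpace d ≃ₗ[ℝ] ℝ × EuclideanSpace ℝ (Fin d) where
  toFun x := (x 0, WithLp.toLp 2 fun i => x i.succ)
  invFun y := WithLp.toLp 2 (Fin.cons y.1 y.2 : Fin (d + 1) → ℝ)
  map_add' x y := by ext <;> simp
  map_smul' c x := by ext <;> simp
  left_inv x := by
    ext i
    refine Fin.cases ?_ (fun j => ?_) i <;> simp
  right_inv y := by ext <;> simp

lemma form_toMinkowski (x y : LSpace d) :
    form _ (toMinkowski d x) (toMinkowski d y) = lorentzProd x y := by
  rw [form_apply, lorentzProd, PiLp.inner_apply]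
  simp only [toMinkowski, LinearEquiv.coe_mk, LinearMap.coe_mk, AddHom.coe_mk]
  simp only [RCLike.inner_apply, conj_trivial]
  rw [neg_add_eq_sub]
  congr 1
  exact Finset.sum_congr rfl fun i _ => mul_comm _ _

lemma toMinkowski_fst (x : LSpace d) : (toMinkowski d x).1 = x 0 := rfl

/-- The Lorentzian scalar product as a bilinear form on `LSpace d`. -/
def lform (d : ℕ) : LinearMap.BilinForm ℝ (LSpace d) :=
  (form (EuclideanSpace ℝ (Fin d))).compl₁₂ (toMinkowski d).toLinearMap (toMinkowski d).toLinearMap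

lemma lform_def (x y : LSpace d) :
    lform d x y = form _ (toMinkowski d x) (toMinkowski d y) := rfl

lemma lform_comm (x y : LSpace d) : lform d x y = lform d y x := form_comm _ _

lemma lform_add_self (x y : LSpace d) :
    lform d (x + y) (x + y) = lform d x x + 2 * lform d x y + lform d y y := by
  simp only [lform_def, map_add (toMinkowski d), form_add_self]

lemma lform_smul_self (c : ℝ) (x : LSpace d) : lform d (c • x) (c • x) = c ^ 2 * lform d x x := by
  simp only [lform_def, map_smul (toMinkowski d), form_smul_self]

lemma mem_tangencySphere_iff {x : LSpace d} :
    x ∈ tangencySphere d ↔ ‖x‖ = 1 ∧ lform d x x = 0 ∧ 0 < x 0 := by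
  rw [tangencySphere, mem_ofPred_eq, mem_sphere_zero_iff_norm, lform_def, form_toMinkowski]
  refine and_congr_right fun h1 => and_congr_right fun h2 => ⟨fun h3 => ?_, le_of_lt⟩
  refine lt_of_le_of_ne h3 fun h0 => ?_
  rw [← form_toMinkowski] at h2
  have hz := eq_zero_of_fst_eq_zero h2.le h0.symm
  rw [LinearEquiv.map_eq_zero_iff] at hz
  simp [hz] at h1

lemma isFuture_of_mem_tangencySphere {x : LSpace d} (h : x ∈ tangencySphere d) :
    IsFuture (toMinkowski d x) := by
  rw [mem_tangencySphere_iff] at h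
  exact ⟨h.2.1.le, h.2.2⟩

/-- Normalizing a path in the span that starts at a relative interior point `t` of a set `X` in
the sphere gives points that are initially in the relative interior of `X`. -/
lemma eventually_normalize_mem {X : Set (LSpace d)} {t : LSpace d} (ht : t ∈ sphericalRelint X)
    (ht1 : ‖t‖ = 1) {γ : ℝ → LSpace d} {l : Filter ℝ} (hγ : Tendsto γ l (𝓝 t))
    (hγX : ∀ᶠ ε in l, γ ε ∈ Submodule.span ℝ X) :
    ∀ᶠ ε in l, γ ε ≠ 0 ∧ ‖γ ε‖⁻¹ • γ ε ∈ sphericalRelint X := by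
  have h0 : ∀ᶠ ε in l, γ ε ≠ 0 :=
    hγ.eventually_ne (by rw [← norm_ne_zero_iff, ht1]; exact one_ne_zero)
  have hlim : Tendsto (fun ε => ‖γ ε‖⁻¹ • γ ε) l (𝓝 t) := by
    have := (hγ.norm.inv₀ (by rw [ht1]; exact one_ne_zero)).smul hγ
    simpa [ht1] using this
  have hlim2 : Tendsto (fun ε => ‖γ ε‖⁻¹ • γ ε) l
      (𝓝[(Submodule.span ℝ X : Set (LSpace d)) ∩ Metric.sphere 0 1] t) := by
    refine tendsto_nhdsWithin_iff.2 ⟨hlim, ?_⟩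
    filter_upwards [h0, hγX] with ε h1 h2
    refine ⟨Submodule.smul_mem _ _ h2, ?_⟩
    rw [mem_sphere_zero_iff_norm, norm_smul, norm_inv, norm_norm,
      inv_mul_cancel₀ (norm_ne_zero_iff.2 h1)]
  have h2 : ∀ᶠ x in 𝓝[(Submodule.span ℝ X : Set (LSpace d)) ∩ Metric.sphere 0 1] t,
      x ∈ sphericalRelint X := by
    have h3 : ∀ᶠ x in 𝓝[(Submodule.span ℝ X : Set (LSpace d)) ∩ Metric.sphere 0 1] t, x ∈ X := ht.2
    filter_upwards [h3, eventually_eventually_nhdsWithin.2 h3] with x h4 h5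
    exact ⟨h4, h5⟩
  filter_upwards [h0, hlim2.eventually h2] with ε h3 h4
  exact ⟨h3, h4⟩

/-- A linear functional that is nonpositive on `X` and vanishes at a relative interior point of `X`
vanishes on all of `X`. -/
lemma eq_zero_of_relint {X : Set (LSpace d)} {t : LSpace d} (ht : t ∈ sphericalRelint X)
    (ht1 : ‖t‖ = 1) {f : LSpace d →ₗ[ℝ] ℝ} (hf : ∀ x ∈ X, f x ≤ 0) (hft : f t = 0) :
    ∀ x ∈ X, f x = 0 := by
  intro x hx
  refine le_antisymm (hf x hx) ?_
  have hlim : Tendsto (fun ε : ℝ => t - ε • x) (𝓝[>] 0) (𝓝 t) := by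
    have : Continuous fun ε : ℝ => t - ε • x := by fun_prop
    simpa using (this.tendsto 0).mono_left (nhdsWithin_le_nhds (s := Ioi 0))
  have h1 := eventually_normalize_mem ht ht1 hlim (Eventually.of_forall fun ε =>
    Submodule.sub_mem _ (Submodule.subset_span ht.1)
      (Submodule.smul_mem _ _ (Submodule.subset_span hx)))
  obtain ⟨ε, ⟨h2, h3⟩, h4⟩ := (h1.and self_mem_nhdsWithin).exists
  have h5 := hf _ h3.1
  rw [map_smul, map_sub, map_smul, hft, zero_sub, smul_eq_mul, smul_eq_mul] at h5
  have h6 := nonpos_of_mul_nonpos_right h5 (inv_pos.2 (norm_pos_iff.2 h2))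
  have h7 : (0 : ℝ) < ε := h4
  nlinarith

/-- The span of a tangent set of dimension at least two contains no timelike vector: otherwise
the light cone in the span could be moved along near the point of tangency. -/
lemma lform_nonneg_of_tangent {X : Set (LSpace d)} {t : LSpace d}
    (ht : sphericalRelint X ∩ tangencySphere d = {t})
    (hdim : 3 ≤ Module.finrank ℝ (Submodule.span ℝ X)) {w : LSpace d}
    (hw : w ∈ Submodule.span ℝ X) : 0 ≤ lform d w w := by
  by_contra! hneg
  obtain ⟨htX, htS⟩ : t ∈ sphericalRelint X ∩ tangencySphere d := by rw [ht]; rfl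
  obtain ⟨ht1, htt, ht0⟩ := mem_tangencySphere_iff.1 htS
  have htW : t ∈ Submodule.span ℝ X := Submodule.subset_span htX.1
  have htw : lform d t w ≠ 0 := by
    intro h0
    have := form_self_nonneg_of_orthogonal (t := toMinkowski d t) (y := toMinkowski d w) htt ht0 h0
    exact absurd hneg (not_lt.2 this)
  -- a spacelike vector `y` of the span, orthogonal to `t`
  obtain ⟨y, hyW, hyt, hy⟩ : ∃ y ∈ Submodule.span ℝ X, lform d t y = 0 ∧ 0 < lform d y y := by
    have hlt : Submodule.span ℝ {t} < Submodule.span ℝ X ⊓ LinearMap.ker (lform d t) := by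
      refine lt_of_le_of_ne ?_ fun he => ?_
      · rw [Submodule.span_singleton_le_iff_mem]
        exact ⟨htW, htt⟩
      · have h1 := finrank_span_le_card (R := ℝ) ({t} : Set (LSpace d))
        simp only [toFinset_singleton, Finset.card_singleton] at h1
        rw [he] at h1
        have h2 := Submodule.finrank_sup_add_finrank_inf_eq (Submodule.span ℝ X)
          (LinearMap.ker (lform d t))
        have h3 := Submodule.finrank_le (Submodule.span ℝ X ⊔ LinearMap.ker (lform d t))
        have h4 := LinearMap.finrank_range_add_finrank_ker (lform d t)
        have h5 := Submodule.finrank_le (LinearMap.range (lform d t))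
        rw [Module.finrank_self] at h5
        omega
    obtain ⟨y, ⟨hyW, hyt⟩, hy⟩ := SetLike.exists_of_lt hlt
    have hyt : lform d t y = 0 := hyt
    refine ⟨y, hyW, hyt,
      lt_of_le_of_ne (form_self_nonneg_of_orthogonal htt ht0 hyt) fun h0 => hy ?_⟩
    have := parallel_of_orthogonal (t := toMinkowski d t) (y := toMinkowski d y) htt hyt h0.symm
    rw [← map_smul, ← map_smul, (toMinkowski d).injective.eq_iff, toMinkowski_fst,
      toMinkowski_fst] at this
    rw [Submodule.mem_span_singleton]
    exact ⟨(t 0)⁻¹ * y 0, by rw [mul_smul, ← this, smul_smul, inv_mul_cancel₀ ht0.ne', one_smul]⟩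
  -- reflecting `t` in `y + ε w` gives lightlike vectors of the span that converge to `t`
  let D : ℝ → ℝ := fun ε => lform d (y + ε • w) (y + ε • w)
  have hD : ∀ ε, D ε = lform d y y + ε * (2 * lform d y w) + ε ^ 2 * lform d w w := fun ε => by
    simp only [D]
    rw [lform_add_self, lform_smul_self, map_smul, smul_eq_mul]; ring
  have hDc : Continuous D := by
    rw [show D = _ from funext hD]; fun_prop
  have hD0 : D 0 = lform d y y := by simp [D]
  let γ : ℝ → LSpace d := fun ε => t - (2 * (ε * lform d t w) / D ε) • (y + ε • w)
  have hγ : Tendsto γ (𝓝[>] 0) (𝓝 t) := by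
    have hc : ContinuousAt γ 0 := by
      have h1 : ContinuousAt (fun ε : ℝ => 2 * (ε * lform d t w)) 0 := by fun_prop
      have h2 : ContinuousAt (fun ε : ℝ => y + ε • w) 0 := by fun_prop
      have h3 := h1.div hDc.continuousAt (by rw [hD0]; exact hy.ne')
      exact continuousAt_const.sub (h3.smul h2)
    have h0 : γ 0 = t := by simp [γ]
    have := hc.tendsto.mono_left (nhdsWithin_le_nhds (s := Ioi 0))
    rwa [h0] at this
  have h1 := eventually_normalize_mem htX ht1 hγ (Eventually.of_forall fun ε =>
    Submodule.sub_mem _ htW (Submodule.smul_mem _ _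
      (Submodule.add_mem _ hyW (Submodule.smul_mem _ _ hw))))
  have h2 : ∀ᶠ ε in 𝓝[>] (0 : ℝ), 0 < D ε :=
    (hDc.continuousAt.eventually_const_lt (by rw [hD0]; exact hy)).filter_mono nhdsWithin_le_nhds
  have h3 : ∀ᶠ ε in 𝓝[>] (0 : ℝ), 0 < (γ ε) 0 := by
    have hc : Continuous fun x : LSpace d => x 0 := by fun_prop
    exact ((hc.tendsto t).comp hγ).eventually_const_lt ht0
  obtain ⟨ε, ⟨⟨⟨hne, hmem⟩, hDε⟩, hγ0⟩, hε⟩ :=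
    (((h1.and h2).and h3).and self_mem_nhdsWithin).exists
  have hε : 0 < ε := hε
  have htyw : lform d t (y + ε • w) = ε * lform d t w := by
    rw [map_add, hyt, zero_add, map_smul, smul_eq_mul]
  have hnull : lform d (γ ε) (γ ε) = 0 := by
    simp only [γ]
    rw [sub_eq_add_neg, ← neg_smul, lform_add_self, lform_smul_self, map_smul, smul_eq_mul, htyw,
      htt]
    change 0 + 2 * (-(2 * (ε * lform d t w) / D ε) * (ε * lform d t w)) +
      (-(2 * (ε * lform d t w) / D ε)) ^ 2 * D ε = 0
    field_simp
    ring
  have heq : ‖γ ε‖⁻¹ • γ ε = t := by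
    have : ‖γ ε‖⁻¹ • γ ε ∈ sphericalRelint X ∩ tangencySphere d := by
      refine ⟨hmem, mem_tangencySphere_iff.2 ⟨?_, ?_, ?_⟩⟩
      · rw [norm_smul, norm_inv, norm_norm, inv_mul_cancel₀ (norm_ne_zero_iff.2 hne)]
      · rw [lform_smul_self, hnull, mul_zero]
      · rw [PiLp.smul_apply, smul_eq_mul]
        exact mul_pos (inv_pos.2 (norm_pos_iff.2 hne)) hγ0
    rwa [ht] at this
  have h4 : lform d t (γ ε) = 0 := by
    have : lform d t (‖γ ε‖⁻¹ • γ ε) = 0 := by rw [heq, htt]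
    rw [map_smul, smul_eq_mul] at this
    exact (mul_eq_zero.1 this).resolve_left (inv_ne_zero (norm_ne_zero_iff.2 hne))
  simp only [γ, map_sub, map_smul, htt, htyw, smul_eq_mul, zero_sub, neg_eq_zero, mul_eq_zero,
    div_eq_zero_iff, two_ne_zero, hε.ne', htw, hDε.ne', or_self] at h4

end Tangent

namespace SphericalPolytope.FaceModel

variable {d n : ℕ} {Q : SphericalPolytope d} {Good : Finset (Fin n) → Prop}
  (R : FaceModel Q n Good) {J : Finset (Fin n)} (hJ : ∀ S ⊆ J, Good S) (hJd : J.card = d)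
  {o : Fin n} (ho : o ∉ J) {k : ℕ} (hQ : Q.IsScribed k)
include hJ hJd ho hQ

lemma exists_tangency {S : Finset (Fin n)} (hS : S ⊆ J) (hSk : S.card = k + 1) :
    ∃ t, sphericalRelint (R.face S) ∩ tangencySphere d = {t} :=
  hQ _ (R.face_mem S (hJ S hS)) (by rw [(R.finrank_span_face hJ hJd ho hS).1, hSk])

/-- Each simplex facet contains a point of the light cone. -/
lemma exists_future (hkd : k < d) :
    ∃ c : Fin n → ℝ, (∀ i, 0 ≤ c i) ∧ IsFuture (toMinkowski d (∑ i ∈ J, c i • R.vert i)) := by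
  classical
  obtain ⟨S, hS, hSk⟩ := Finset.exists_subset_card_eq (s := J) (n := k + 1) (by omega)
  obtain ⟨t, ht⟩ := R.exists_tangency hJ hJd ho hQ hS hSk
  obtain ⟨htX, htS⟩ : t ∈ sphericalRelint (R.face S) ∩ tangencySphere d := by rw [ht]; rfl
  obtain ⟨c, hc, hct⟩ := R.exists_coeff hJ hJd ho hS htX.1
  refine ⟨fun i => if i ∈ S then c i else 0, fun i => ?_, ?_⟩
  · dsimp only
    split_ifs with h
    · exact hc i h
    · exact le_rfl
  · have : ∑ i ∈ J, (if i ∈ S then c i else 0) • R.vert i = t := by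
      rw [hct, ← Finset.sum_subset hS]
      · exact Finset.sum_congr rfl fun i hi => by rw [if_pos hi]
      · intro i _ hi
        rw [if_neg hi, zero_smul]
    rw [this]
    exact isFuture_of_mem_tangencySphere htS

lemma lform_nonneg (hk : 2 ≤ k) (hkd : k < d) {S₀ : Finset (Fin n)} (hS₀ : S₀ ⊆ J)
    (hcard : S₀.card ≤ k + 1) {z : LSpace d} (hz : z ∈ Submodule.span ℝ (R.vert '' S₀)) :
    0 ≤ lform d z z := by
  obtain ⟨S, hS₀S, hS, hSk⟩ := Finset.exists_subsuperset_card_eq (n := k + 1) hS₀ hcard (by omega)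
  obtain ⟨t, ht⟩ := R.exists_tangency hJ hJd ho hQ hS hSk
  refine lform_nonneg_of_tangent ht (by rw [(R.finrank_span_face hJ hJd ho hS).1]; omega) ?_
  rw [(R.finrank_span_face hJ hJd ho hS).2]
  exact Submodule.span_mono (image_mono (by exact_mod_cast hS₀S)) hz

/-- The only lightlike direction in a tangent face is that of its point of tangency, which is in
the relative interior; so proper faces of a tangent face are spacelike. -/
lemma eq_zero_of_lform_eq_zero (hk : 2 ≤ k) (hkd : k < d) {S₀ : Finset (Fin n)} (hS₀ : S₀ ⊆ J)
    (hcard : S₀.card ≤ k) {z : LSpace d} (hz : z ∈ Submodule.span ℝ (R.vert '' S₀))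
    (h0 : lform d z z = 0) : z = 0 := by
  obtain ⟨S, hS₀S, hS, hSk⟩ := Finset.exists_subsuperset_card_eq (n := k + 1) hS₀ (by omega)
    (by omega)
  obtain ⟨j, hj, hjS₀⟩ := Finset.exists_mem_notMem_of_card_lt_card (s := S₀) (t := S) (by omega)
  have hGS := hJ S hS
  obtain ⟨t, ht⟩ := R.exists_tangency hJ hJd ho hQ hS hSk
  obtain ⟨htX, htS⟩ : t ∈ sphericalRelint (R.face S) ∩ tangencySphere d := by rw [ht]; rfl
  obtain ⟨ht1, htt, ht0⟩ := mem_tangencySphere_iff.1 htS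
  have hspan := R.finrank_span_face hJ hJd ho hS
  have hzW : z ∈ Submodule.span ℝ (R.face S) := by
    rw [hspan.2]
    exact Submodule.span_mono (image_mono (by exact_mod_cast hS₀S)) hz
  have hpsd := fun w => lform_nonneg_of_tangent (w := w) ht (by rw [hspan.1]; omega)
  have h1 := hpsd (t + z) (Submodule.add_mem _ (Submodule.subset_span htX.1) hzW)
  have h2 := hpsd (t + (-1 : ℝ) • z) (Submodule.add_mem _ (Submodule.subset_span htX.1)
    (Submodule.smul_mem _ _ hzW))
  rw [lform_add_self, htt, h0] at h1
  rw [lform_add_self, lform_smul_self, htt, h0, map_smul, smul_eq_mul] at h2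
  have htz : lform d t z = 0 := by linarith
  have hpar := parallel_of_orthogonal (t := toMinkowski d t) (y := toMinkowski d z) htt htz h0
  rw [← map_smul, ← map_smul, (toMinkowski d).injective.eq_iff, toMinkowski_fst,
    toMinkowski_fst] at hpar
  obtain ⟨f, hf, -, hf0, hf1⟩ := R.exists_functional
    (hJ _ ((Finset.erase_subset j S).trans hS))
  have hfz : f z = 0 := by
    have : Submodule.span ℝ (R.vert '' S₀) ≤ LinearMap.ker f := by
      rw [Submodule.span_le]
      rintro _ ⟨i, hi, rfl⟩
      exact hf0 i (Finset.mem_erase.2 ⟨fun h => hjS₀ (h ▸ hi), hS₀S hi⟩)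
    exact this hz
  have hft : f t ≠ 0 := fun hft =>
    (hf1 j (Finset.notMem_erase j S)).ne (eq_zero_of_relint htX ht1
      (fun x hx => hf x (R.face_subset hGS hx)) hft _ ((R.vert_mem_iff S hGS j).2 hj))
  have h3 := congrArg f hpar
  rw [map_smul, map_smul, hfz, smul_zero, eq_comm, smul_eq_mul, mul_eq_zero,
    or_iff_left hft] at h3
  rw [h3, zero_smul] at hpar
  exact (smul_eq_zero.1 hpar).resolve_left ht0.ne'

end SphericalPolytope.FaceModel

/-! ### Polytopes with tangent edges -/

section

variable {d : ℕ}

/-- If the edge between two points meets the light cone only once and both are spacelike, then the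
edge is tangent to the light cone; otherwise there would be a second point of intersection. -/
lemma lform_of_spacelike {x y : LSpace d} (hx : 0 < lform d x x) (hy : 0 < lform d y y)
    {s r : ℝ} (hs : 0 < s) (hr : 0 < r) (hq : lform d (s • x + r • y) (s • x + r • y) = 0)
    (h0 : 0 < (s • x + r • y) 0)
    (huniq : ∀ s' r' : ℝ, 0 < s' → 0 < r' →
        lform d (s' • x + r' • y) (s' • x + r' • y) = 0 →
        0 < (s' • x + r' • y) 0 → s * r' = r * s') :
    lform d x y < 0 ∧ lform d x y ^ 2 = lform d x x * lform d y y := by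
  have hexp : ∀ a b : ℝ, lform d (a • x + b • y) (a • x + b • y)
      = a ^ 2 * lform d x x + 2 * (a * b * lform d x y) + b ^ 2 * lform d y y := by
    intro a b
    rw [lform_add_self, lform_smul_self, lform_smul_self]
    simp only [map_smul, LinearMap.smul_apply, smul_eq_mul]
    ring
  have hq2 := hq
  rw [hexp] at hq2
  set a := lform d x x
  set b := lform d y y
  set β := lform d x y with hβ
  have hsr := mul_pos hs hr
  have hβ0 : β < 0 := by
    have h1 : s * r * β < 0 := by
      have := mul_pos (pow_pos hs 2) hx
      have := mul_pos (pow_pos hr 2) hy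
      linarith
    exact neg_of_mul_neg_right h1 hsr.le
  refine ⟨hβ0, ?_⟩
  by_contra hne
  -- the two roots have ratio `r / s` and `s a / (r b)`
  have key : (s ^ 2 * a - r ^ 2 * b) ^ 2 = 4 * (s * r) ^ 2 * (β ^ 2 - a * b) := by
    linear_combination (s ^ 2 * a + r ^ 2 * b - 2 * (s * r * β)) * hq2
  have hlt : a * b < β ^ 2 := by
    refine lt_of_le_of_ne ?_ (Ne.symm hne)
    have h1 : 0 ≤ 4 * (s * r) ^ 2 * (β ^ 2 - a * b) := by rw [← key]; positivity
    have := nonneg_of_mul_nonneg_right h1 (by positivity)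
    linarith
  have hneg : lform d ((r * b) • x + (s * a) • y) (s • x + r • y) < 0 := by
    have e : lform d ((r * b) • x + (s * a) • y) (s • x + r • y)
        = 2 * (s * r) * (a * b - β ^ 2) := by
      simp only [map_add, map_smul, LinearMap.add_apply, LinearMap.smul_apply, smul_eq_mul]
      rw [lform_comm y x, ← hβ]
      linear_combination β * hq2
    rw [e]
    exact mul_neg_of_pos_of_neg (by positivity) (by linarith)
  have hq' : lform d ((r * b) • x + (s * a) • y) ((r * b) • x + (s * a) • y) = 0 := by
    rw [hexp]; linear_combination a * b * hq2
  have hfut : IsFuture (toMinkowski d ((r * b) • x + (s * a) • y)) :=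
    isFuture_of_form_neg hq'.le (y := toMinkowski d (s • x + r • y)) ⟨hq.le, h0⟩ hneg
  have h1 := huniq (r * b) (s * a) (by positivity) (by positivity) hq' hfut.2
  have h2 : (s ^ 2 * a - r ^ 2 * b) ^ 2 = 0 := by
    have : s ^ 2 * a - r ^ 2 * b = 0 := by linear_combination h1
    rw [this]; ring
  rw [key] at h2
  have : 0 < 4 * (s * r) ^ 2 * (β ^ 2 - a * b) := mul_pos (by positivity) (by linarith)
  exact this.ne' h2

/-- At least three spacelike vectors with tangent connecting edges are independent. -/
lemma card_le_of_tangent {ι : Type*} [Fintype ι] (hι : 3 ≤ Fintype.card ι) (x : ι → LSpace d)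
    (hx : ∀ i, 0 < lform d (x i) (x i))
    (hxx : ∀ i j, i ≠ j → lform d (x i) (x j) < 0 ∧
      lform d (x i) (x j) ^ 2 = lform d (x i) (x i) * lform d (x j) (x j)) :
    Fintype.card ι ≤ d + 1 := by
  classical
  set a : ι → ℝ := fun i => Real.sqrt (lform d (x i) (x i)) with ha
  have ha0 : ∀ i, 0 < a i := fun i => Real.sqrt_pos.2 (hx i)
  have ha2 : ∀ i, lform d (x i) (x i) = a i ^ 2 := fun i => (Real.sq_sqrt (hx i).le).symm
  have haa : ∀ i j, i ≠ j → lform d (x i) (x j) = -(a i * a j) := by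
    intro i j hij
    obtain ⟨h1, h2⟩ := hxx i j hij
    rw [ha2, ha2, ← mul_pow] at h2
    rcases sq_eq_sq_iff_eq_or_eq_neg.1 h2 with h | h
    · have := mul_pos (ha0 i) (ha0 j)
      linarith
    · exact h
  have hli : LinearIndependent ℝ x := by
    rw [Fintype.linearIndependent_iff]
    intro g hg
    -- pairing the relation with `x j` determines the coefficient `g j` from their weighted sum
    have h1 : ∀ j, 2 * (g j * a j) = ∑ i, g i * a i := by
      intro j
      have h2 := congrArg (lform d (x j)) hg
      rw [map_sum, map_zero] at h2
      have h3 : ∀ i, lform d (x j) (g i • x i)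
          = a j * (-(g i * a i) + if i = j then 2 * (g i * a i) else 0) := by
        intro i
        rw [map_smul, smul_eq_mul]
        split_ifs with h
        · rw [h, ha2]; ring
        · rw [haa j i (Ne.symm h)]; ring
      rw [Finset.sum_congr rfl fun i _ => h3 i, ← Finset.mul_sum, Finset.sum_add_distrib,
        Finset.sum_neg_distrib, Finset.sum_ite_eq' Finset.univ j] at h2
      have h4 := (mul_eq_zero.1 h2).resolve_left (ha0 j).ne'
      simp only [Finset.mem_univ, if_true] at h4
      linarith
    have h5 : 2 * ∑ i, g i * a i = Fintype.card ι * ∑ i, g i * a i := by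
      conv_lhs => rw [Finset.mul_sum, Finset.sum_congr rfl fun i _ => h1 i]
      simp
    have h6 : ∑ i, g i * a i = 0 := by
      have h7 : ((Fintype.card ι : ℝ) - 2) * ∑ i, g i * a i = 0 := by linarith
      refine (mul_eq_zero.1 h7).resolve_left ?_
      have : (3 : ℝ) ≤ Fintype.card ι := by exact_mod_cast hι
      linarith
    intro i
    have h7 := h1 i
    rw [h6] at h7
    have h8 : g i * a i = 0 := by linarith
    exact (mul_eq_zero.1 h8).resolve_right (ha0 i).ne'
  have := hli.fintype_card_le_finrank
  rwa [finrank_euclideanSpace_fin] at this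

end

namespace SphericalPolytope.FaceModel

variable {d n : ℕ} {Q : SphericalPolytope d} {Good : Finset (Fin n) → Prop}
  (R : FaceModel Q n Good)

/-- An edge meets the light cone in a point of its relative interior, and nowhere else. The line
spanned by it need not be tangent to the light cone: it may also cross it. -/
lemma exists_edge_point {J : Finset (Fin n)} (hJ : ∀ S ⊆ J, Good S) (hJd : J.card = d)
    {o : Fin n} (ho : o ∉ J) (hQ : Q.IsScribed 1) {i j : Fin n} (hi : i ∈ J) (hj : j ∈ J)
    (hij : i ≠ j) :
    ∃ s r : ℝ, 0 < s ∧ 0 < r ∧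
      lform d (s • R.vert i + r • R.vert j) (s • R.vert i + r • R.vert j) = 0 ∧
      0 < (s • R.vert i + r • R.vert j) 0 ∧
      ∀ s' r' : ℝ, 0 < s' → 0 < r' →
        lform d (s' • R.vert i + r' • R.vert j) (s' • R.vert i + r' • R.vert j) = 0 →
        0 < (s' • R.vert i + r' • R.vert j) 0 → s * r' = r * s' := by
  have hS : ({i, j} : Finset (Fin n)) ⊆ J := by
    intro x hx
    rcases Finset.mem_insert.1 hx with rfl | hx
    · exact hi
    · rwa [Finset.mem_singleton.1 hx]
  have hGS := hJ _ hS
  obtain ⟨t, ht⟩ := R.exists_tangency hJ hJd ho hQ hS (Finset.card_pair hij)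
  obtain ⟨htX, htS⟩ : t ∈ sphericalRelint (R.face {i, j}) ∩ tangencySphere d := by rw [ht]; rfl
  obtain ⟨ht1, htt, ht0⟩ := mem_tangencySphere_iff.1 htS
  obtain ⟨f, -, hfF, hf0, -⟩ := R.exists_functional hGS
  obtain ⟨g, hg, -, hg0, hg1⟩ :=
    R.exists_functional (S := {i}) (hJ _ (Finset.singleton_subset_iff.2 hi))
  obtain ⟨h, hh, -, hh0, hh1⟩ :=
    R.exists_functional (S := {j}) (hJ _ (Finset.singleton_subset_iff.2 hj))
  have hgi : g (R.vert i) = 0 := hg0 i (Finset.mem_singleton_self i)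
  have hgj : g (R.vert j) < 0 := hg1 j (by simpa using hij.symm)
  have hhj : h (R.vert j) = 0 := hh0 j (Finset.mem_singleton_self j)
  have hhi : h (R.vert i) < 0 := hh1 i (by simpa using hij)
  have hiF : R.vert i ∈ R.face {i, j} := (R.vert_mem_iff _ hGS i).2 (by simp)
  have hjF : R.vert j ∈ R.face {i, j} := (R.vert_mem_iff _ hGS j).2 (by simp)
  have hsub := R.face_subset hGS
  obtain ⟨c, hc, hct⟩ := R.exists_coeff hJ hJd ho hS htX.1
  rw [Finset.sum_pair hij] at hct
  have hgt : g t = c j * g (R.vert j) := by simp [hct, hgi]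
  have hht : h t = c i * h (R.vert i) := by simp [hct, hhj]
  have hci : 0 < c i := by
    refine lt_of_le_of_ne (hc i (by simp)) fun h0 => hhi.ne ?_
    exact eq_zero_of_relint htX ht1 (fun x hx => hh x (hsub hx))
      (by rw [hht, ← h0, zero_mul]) _ hiF
  have hcj : 0 < c j := by
    refine lt_of_le_of_ne (hc j (by simp)) fun h0 => hgj.ne ?_
    exact eq_zero_of_relint htX ht1 (fun x hx => hg x (hsub hx))
      (by rw [hgt, ← h0, zero_mul]) _ hjF
  refine ⟨c i, c j, hci, hcj, by rw [← hct]; exact htt, by rw [← hct]; exact ht0, ?_⟩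
  intro s' r' hs' hr' hq h0
  set y := s' • R.vert i + r' • R.vert j with hy
  have hyne : 0 < ‖y‖ := norm_pos_iff.2 fun h => by rw [h] at h0; simp at h0
  -- all positive combinations of the two points are in the relative interior
  have hcomb : ∀ x ∈ Metric.sphere (0 : LSpace d) 1,
      (∃ a b : ℝ, 0 ≤ a ∧ 0 ≤ b ∧ x = a • R.vert i + b • R.vert j) → x ∈ R.face {i, j} := by
    rintro x hx ⟨a, b, ha, hb, rfl⟩
    refine (hfF _ ⟨?_, hx⟩).2 ?_
    · exact Q.cone.add_mem (Q.cone.smul_mem ha (hsub hiF).1)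
        (Q.cone.smul_mem hb (hsub hjF).1)
    · simp [hf0 i, hf0 j]
  have hnorm : ‖y‖⁻¹ • y ∈ Metric.sphere (0 : LSpace d) 1 := by
    rw [mem_sphere_zero_iff_norm, norm_smul, norm_inv, norm_norm, inv_mul_cancel₀ hyne.ne']
  have hrel : ‖y‖⁻¹ • y ∈ sphericalRelint (R.face {i, j}) := by
    refine ⟨hcomb _ hnorm ⟨‖y‖⁻¹ * s', ‖y‖⁻¹ * r', by positivity, by positivity, ?_⟩, ?_⟩
    · rw [mul_smul, mul_smul, ← smul_add]
    · have hgc : Continuous g := g.continuous_of_finiteDimensional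
      have hhc : Continuous h := h.continuous_of_finiteDimensional
      have ho1 : ∀ᶠ x in 𝓝 (‖y‖⁻¹ • y), g x < 0 := by
        refine hgc.continuousAt.eventually_lt_const ?_
        rw [hy, map_smul, map_add, map_smul, map_smul, hgi, smul_zero, zero_add, ← hy]
        exact smul_neg_of_pos_of_neg (inv_pos.2 hyne) (smul_neg_of_pos_of_neg hr' hgj)
      have ho2 : ∀ᶠ x in 𝓝 (‖y‖⁻¹ • y), h x < 0 := by
        refine hhc.continuousAt.eventually_lt_const ?_
        rw [hy, map_smul, map_add, map_smul, map_smul, hhj, smul_zero, add_zero, ← hy]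
        exact smul_neg_of_pos_of_neg (inv_pos.2 hyne) (smul_neg_of_pos_of_neg hs' hhi)
      filter_upwards [nhdsWithin_le_nhds ho1, nhdsWithin_le_nhds ho2, self_mem_nhdsWithin]
        with x hx1 hx2 hx3
      have hx4 := hx3.1
      rw [(R.finrank_span_face hJ hJd ho hS).2, Finset.coe_pair, image_pair] at hx4
      obtain ⟨a, b, rfl⟩ := Submodule.mem_span_pair.1 hx4
      refine hcomb _ hx3.2 ⟨a, b, ?_, ?_, rfl⟩
      · rw [map_add, map_smul, map_smul, hhj, smul_zero, add_zero, smul_eq_mul] at hx2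
        exact (pos_of_mul_neg_left hx2 hhi.le).le
      · rw [map_add, map_smul, map_smul, hgi, smul_zero, zero_add, smul_eq_mul] at hx1
        exact (pos_of_mul_neg_left hx1 hgj.le).le
  have heq : ‖y‖⁻¹ • y = t := by
    have : ‖y‖⁻¹ • y ∈ sphericalRelint (R.face {i, j}) ∩ tangencySphere d := by
      refine ⟨hrel, mem_tangencySphere_iff.2 ⟨mem_sphere_zero_iff_norm.1 hnorm, ?_, ?_⟩⟩
      · rw [lform_smul_self, hq, mul_zero]
      · rw [PiLp.smul_apply, smul_eq_mul]
        exact mul_pos (inv_pos.2 hyne) h0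
    rwa [ht] at this
  have e1 := congrArg g heq
  have e2 := congrArg h heq
  rw [hgt, hy, map_smul, map_add, map_smul, map_smul, hgi, smul_zero, zero_add, ← hy,
    smul_eq_mul, smul_eq_mul, ← mul_assoc] at e1
  rw [hht, hy, map_smul, map_add, map_smul, map_smul, hhj, smul_zero, add_zero, ← hy,
    smul_eq_mul, smul_eq_mul, ← mul_assoc] at e2
  rw [← mul_right_cancel₀ hgj.ne e1, ← mul_right_cancel₀ hhi.ne e2]
  ring

/-- Points that are pairwise connected by edges meeting the light cone once are few:
at most one is causal to the future, at most one causal to the past, and the others are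
independent if there are at least three of them. -/
theorem card_le_of_tangent_edges (R : FaceModel Q n Good) (hQ : Q.IsScribed 1) {m : ℕ}
    (x : Fin m → Fin n)
    (hx : Function.Injective x) (hpair : ∀ i j, ∃ J : Finset (Fin n), x i ∈ J ∧ x j ∈ J ∧
      (∀ S ⊆ J, Good S) ∧ J.card = d ∧ ∃ o, o ∉ J) : m ≤ d + 4 := by
  classical
  have hedge : ∀ i j, i ≠ j → ∃ s r : ℝ, 0 < s ∧ 0 < r ∧
      lform d (s • R.vert (x i) + r • R.vert (x j)) (s • R.vert (x i) + r • R.vert (x j)) = 0 ∧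
      0 < (s • R.vert (x i) + r • R.vert (x j)) 0 ∧
      ∀ s' r' : ℝ, 0 < s' → 0 < r' →
        lform d (s' • R.vert (x i) + r' • R.vert (x j))
          (s' • R.vert (x i) + r' • R.vert (x j)) = 0 →
        0 < (s' • R.vert (x i) + r' • R.vert (x j)) 0 → s * r' = r * s' := by
    intro i j hij
    obtain ⟨J, hi, hj, hJ, hJd, o, ho⟩ := hpair i j
    exact R.exists_edge_point hJ hJd ho hQ hi hj (hx.ne hij)
  have hfut : (Finset.univ.filter fun i =>
      lform d (R.vert (x i)) (R.vert (x i)) ≤ 0 ∧ 0 < R.vert (x i) 0).card ≤ 1 := by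
    rw [Finset.card_le_one]
    intro i hi j hj
    by_contra hij
    simp only [Finset.mem_filter, Finset.mem_univ, true_and] at hi hj
    obtain ⟨s, r, hs, hr, hq, -⟩ := hedge i j hij
    rw [lform_add_self, lform_smul_self, lform_smul_self] at hq
    simp only [map_smul, LinearMap.smul_apply, smul_eq_mul] at hq
    have hfi : IsFuture (toMinkowski d (R.vert (x i))) := hi
    have hfj : IsFuture (toMinkowski d (R.vert (x j))) := hj
    have h1 : 0 ≤ lform d (R.vert (x i)) (R.vert (x j)) := by
      have h2 := mul_nonpos_of_nonneg_of_nonpos (sq_nonneg s) hi.1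
      have h3 := mul_nonpos_of_nonneg_of_nonpos (sq_nonneg r) hj.1
      have h4 : 0 ≤ s * r * lform d (R.vert (x i)) (R.vert (x j)) := by linarith
      exact nonneg_of_mul_nonneg_right h4 (mul_pos hs hr)
    have hpar := hfi.parallel hfj h1
    rw [← map_smul, ← map_smul, (toMinkowski d).injective.eq_iff, toMinkowski_fst,
      toMinkowski_fst] at hpar
    obtain ⟨J, -, hjJ, hJ, -⟩ := hpair i j
    obtain ⟨f, -, -, hf0, hf1⟩ := R.exists_functional
      (S := {x j}) (hJ _ (Finset.singleton_subset_iff.2 hjJ))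
    have h2 := congrArg f hpar
    rw [map_smul, map_smul, hf0 (x j) (Finset.mem_singleton_self _), smul_zero, smul_eq_mul] at h2
    rcases mul_eq_zero.1 h2 with h3 | h3
    · exact hj.2.ne' h3
    · exact (hf1 (x i) (by simpa using hx.ne hij)).ne h3
  have hpast : (Finset.univ.filter fun i =>
      lform d (R.vert (x i)) (R.vert (x i)) ≤ 0 ∧ ¬ 0 < R.vert (x i) 0).card ≤ 1 := by
    rw [Finset.card_le_one]
    intro i hi j hj
    by_contra hij
    simp only [Finset.mem_filter, Finset.mem_univ, true_and, not_lt] at hi hj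
    obtain ⟨s, r, hs, hr, -, h0, -⟩ := hedge i j hij
    simp only [PiLp.add_apply, PiLp.smul_apply, smul_eq_mul] at h0
    have h2 := mul_nonpos_of_nonneg_of_nonpos hs.le hi.2
    have h3 := mul_nonpos_of_nonneg_of_nonpos hr.le hj.2
    linarith
  have hspace : (Finset.univ.filter fun i =>
      ¬ lform d (R.vert (x i)) (R.vert (x i)) ≤ 0).card ≤ d + 2 := by
    by_contra hc
    rw [not_le] at hc
    have h1 := card_le_of_tangent (ι := {i // ¬ lform d (R.vert (x i)) (R.vert (x i)) ≤ 0})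
      (by rw [Fintype.card_subtype]; omega) (fun i => R.vert (x i)) (fun i => not_le.1 i.2)
      (fun i j hij => by
        obtain ⟨s, r, hs, hr, hq, h0, hu⟩ := hedge i j (fun h => hij (Subtype.ext h))
        exact lform_of_spacelike (not_le.1 i.2) (not_le.1 j.2) hs hr hq h0 hu)
    rw [Fintype.card_subtype] at h1
    omega
  have h1 := Finset.card_filter_add_card_filter_not (s := Finset.univ)
    (fun i => lform d (R.vert (x i)) (R.vert (x i)) ≤ 0)
  have h2 := Finset.card_filter_add_card_filter_not
    (s := Finset.univ.filter fun i => lform d (R.vert (x i)) (R.vert (x i)) ≤ 0)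
    (fun i => 0 < R.vert (x i) 0)
  rw [Finset.filter_filter, Finset.filter_filter] at h2
  rw [Finset.card_univ, Fintype.card_fin] at h1
  omega

end SphericalPolytope.FaceModel

/-! ### Gale's evenness condition -/

section Gale

open Polynomial

variable {n : ℕ}

/-- For two neighbouring parameters, any subset of the two is the zero set of a polynomial of
degree at most two that is nonnegative on all parameters. -/
lemma exists_poly_pair {t : Fin n → ℝ} (ht : StrictMono t) {a b : Fin n}
    (hab : (a : ℕ) + 1 = b) (S : Finset (Fin n)) :
    ∃ q : ℝ[X], q.natDegree ≤ 2 ∧ (∀ i, 0 ≤ q.eval (t i)) ∧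
      ∀ i, q.eval (t i) = 0 ↔ i ∈ S ∧ (i = a ∨ i = b) := by
  have hz : ∀ i c, t i - t c = 0 ↔ i = c := fun i c => by rw [sub_eq_zero, ht.injective.eq_iff]
  have hsq : ∀ c : Fin n, ((X - C (t c)) ^ 2 : ℝ[X]).natDegree ≤ 2 := fun c => by
    rw [natDegree_pow, natDegree_X_sub_C]
  by_cases ha : a ∈ S <;> by_cases hb : b ∈ S
  · refine ⟨(X - C (t a)) * (X - C (t b)), ?_, fun i => ?_, fun i => ?_⟩
    · refine natDegree_mul_le.trans ?_
      rw [natDegree_X_sub_C, natDegree_X_sub_C]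
    · simp only [eval_mul, eval_sub, eval_X, eval_C]
      -- no parameter lies strictly between the two
      rcases le_or_gt i a with h | h
      · have h1 := ht.monotone h
        have h2 := ht.monotone (show i ≤ b by rw [Fin.le_def] at h ⊢; omega)
        exact mul_nonneg_of_nonpos_of_nonpos (by linarith) (by linarith)
      · have h1 := ht.monotone h.le
        have h2 := ht.monotone (show b ≤ i by rw [Fin.lt_def] at h; rw [Fin.le_def]; omega)
        exact mul_nonneg (by linarith) (by linarith)
    · simp only [eval_mul, eval_sub, eval_X, eval_C, mul_eq_zero, hz]
      refine ⟨fun h => ⟨?_, h⟩, fun h => h.2⟩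
      rcases h with rfl | rfl
      · exact ha
      · exact hb
  · refine ⟨(X - C (t a)) ^ 2, hsq a, fun i => ?_, fun i => ?_⟩
    · simp only [eval_pow, eval_sub, eval_X, eval_C]; positivity
    · simp only [eval_pow, eval_sub, eval_X, eval_C, ne_eq, OfNat.ofNat_ne_zero,
        not_false_eq_true, pow_eq_zero_iff, hz]
      refine ⟨fun h => ⟨h ▸ ha, Or.inl h⟩, fun h => h.2.resolve_right ?_⟩
      rintro rfl; exact hb h.1
  · refine ⟨(X - C (t b)) ^ 2, hsq b, fun i => ?_, fun i => ?_⟩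
    · simp only [eval_pow, eval_sub, eval_X, eval_C]; positivity
    · simp only [eval_pow, eval_sub, eval_X, eval_C, ne_eq, OfNat.ofNat_ne_zero,
        not_false_eq_true, pow_eq_zero_iff, hz]
      refine ⟨fun h => ⟨h ▸ hb, Or.inr h⟩, fun h => h.2.resolve_left ?_⟩
      rintro rfl; exact ha h.1
  · refine ⟨1, by simp, fun i => by simp, fun i => ?_⟩
    simp only [eval_one, one_ne_zero, false_iff, not_and, not_or]
    refine fun hi => ⟨?_, ?_⟩
    · rintro rfl; exact ha hi
    · rintro rfl; exact hb hi

variable {m : ℕ}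

/-- The vertices other than the first one, `apex`, form consecutive pairs. -/
def pairVertex (h : 2 * m + 1 ≤ n) (p : Fin m × Bool) : Fin n :=
  ⟨2 * p.1 + 1 + p.2.toNat, by have := p.1.2; have := Bool.toNat_le p.2; omega⟩

/-- The first vertex. -/
def apex (h : 2 * m + 1 ≤ n) : Fin n := ⟨0, by omega⟩

lemma pairVertex_injective (h : 2 * m + 1 ≤ n) : Function.Injective (pairVertex h) := by
  rintro ⟨i, b⟩ ⟨j, c⟩ he
  simp only [pairVertex, Fin.mk.injEq] at he
  cases b <;> cases c <;> simp only [Bool.toNat_true, Bool.toNat_false] at he <;>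
    first
    | omega
    | rw [Fin.ext (show (i : ℕ) = j by omega)]

lemma pairVertex_ne_apex (h : 2 * m + 1 ≤ n) (p : Fin m × Bool) : pairVertex h p ≠ apex h := by
  simp only [pairVertex, apex, ne_eq, Fin.mk.injEq]
  omega

/-- The vertices of the pairs in `J`. -/
def pairSet (h : 2 * m + 1 ≤ n) (J : Finset (Fin m)) : Finset (Fin n) :=
  (J ×ˢ (Finset.univ : Finset Bool)).map ⟨pairVertex h, pairVertex_injective h⟩

lemma mem_pairSet (h : 2 * m + 1 ≤ n) {J : Finset (Fin m)} {i : Fin n} :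
    i ∈ pairSet h J ↔ ∃ j ∈ J, i = pairVertex h (j, false) ∨ i = pairVertex h (j, true) := by
  simp only [pairSet, Finset.mem_map, Finset.mem_product, Finset.mem_univ, and_true,
    Function.Embedding.coeFn_mk, Prod.exists, Bool.exists_bool]
  exact exists_congr fun j => by
    rw [eq_comm (a := i), eq_comm (a := i)]; tauto

lemma pairVertex_mem_pairSet (h : 2 * m + 1 ≤ n) {J : Finset (Fin m)} {p : Fin m × Bool} :
    pairVertex h p ∈ pairSet h J ↔ p.1 ∈ J := by
  simp only [pairSet, Finset.mem_map, Finset.mem_product, Finset.mem_univ, and_true,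
    Function.Embedding.coeFn_mk]
  refine ⟨fun ⟨q, hq, he⟩ => ?_, fun hp => ⟨p, hp, rfl⟩⟩
  rwa [← pairVertex_injective h he]

lemma card_pairSet (h : 2 * m + 1 ≤ n) (J : Finset (Fin m)) :
    (pairSet h J).card = 2 * J.card := by
  simp [pairSet, mul_comm]

lemma apex_notMem_pairSet (h : 2 * m + 1 ≤ n) (J : Finset (Fin m)) : apex h ∉ pairSet h J := by
  rw [mem_pairSet]
  rintro ⟨j, -, h1 | h1⟩
  · exact pairVertex_ne_apex h _ h1.symm
  · exact pairVertex_ne_apex h _ h1.symm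

lemma exists_poly_pairSet (h : 2 * m + 1 ≤ n) {t : Fin n → ℝ} (ht : StrictMono t)
    (J : Finset (Fin m)) (S : Finset (Fin n)) :
    ∃ p : ℝ[X], p.natDegree ≤ 2 * J.card ∧ (∀ i, 0 ≤ p.eval (t i)) ∧
      ∀ i, p.eval (t i) = 0 ↔ i ∈ S ∧ i ∈ pairSet h J := by
  choose q h1 h2 h3 using fun j : Fin m => exists_poly_pair ht
    (a := pairVertex h (j, false)) (b := pairVertex h (j, true)) (by simp [pairVertex]) S
  refine ⟨∏ j ∈ J, q j, ?_, fun i => ?_, fun i => ?_⟩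
  · refine (natDegree_prod_le _ _).trans ?_
    refine (Finset.sum_le_card_nsmul _ _ 2 fun j _ => h1 j).trans ?_
    rw [smul_eq_mul, mul_comm]
  · rw [eval_prod]
    exact Finset.prod_nonneg fun j _ => h2 j i
  · rw [eval_prod, Finset.prod_eq_zero_iff, mem_pairSet]
    simp only [h3]
    exact ⟨fun ⟨a, b, c, e⟩ => ⟨c, a, b, e⟩, fun ⟨c, a, b, e⟩ => ⟨a, b, c, e⟩⟩

/-- Subsets of a union of `d / 2` pairs, together with the first vertex if `d` is odd, are faces
of a cyclic `d`-polytope. -/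
lemma isGaleFace_of_subset (h : 2 * m + 1 ≤ n) {d : ℕ} {t : Fin n → ℝ} (ht : StrictMono t)
    {J : Finset (Fin m)} {O : Finset (Fin n)} (hO : O ⊆ {apex h}) (hd : O.card + 2 * J.card = d)
    {S : Finset (Fin n)} (hS : S ⊆ O ∪ pairSet h J) : IsGaleFace d t S := by
  obtain ⟨p, hp1, hp2, hp3⟩ := exists_poly_pairSet h ht J S
  by_cases ha : apex h ∈ S
  · have hOa : O = {apex h} := by
      refine Finset.Subset.antisymm hO (Finset.singleton_subset_iff.2 ?_)
      exact (Finset.mem_union.1 (hS ha)).resolve_right (apex_notMem_pairSet h J)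
    subst hOa
    refine ⟨(X - C (t (apex h))) * p, ?_, fun i => ?_, fun i => ?_⟩
    · refine natDegree_mul_le.trans ?_
      rw [natDegree_X_sub_C]
      rw [Finset.card_singleton] at hd
      omega
    · have : t (apex h) ≤ t i := ht.monotone (Fin.le_def.2 (Nat.zero_le _))
      simp only [eval_mul, eval_sub, eval_X, eval_C]
      exact mul_nonneg (by linarith) (hp2 i)
    · simp only [eval_mul, eval_sub, eval_X, eval_C, mul_eq_zero, sub_eq_zero,
        ht.injective.eq_iff, hp3]
      constructor
      · rintro (rfl | h1)
        · exact ha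
        · exact h1.1
      · intro hi
        rcases Finset.mem_union.1 (hS hi) with h1 | h1
        · exact Or.inl (Finset.mem_singleton.1 h1)
        · exact Or.inr ⟨hi, h1⟩
  · refine ⟨p, by omega, hp2, fun i => ?_⟩
    rw [hp3]
    refine ⟨fun hi => hi.1, fun hi => ⟨hi, (Finset.mem_union.1 (hS hi)).resolve_left fun h1 => ?_⟩⟩
    rw [Finset.mem_singleton.1 (hO h1)] at hi
    exact ha hi

end Gale

/-! ### Projection along a spacelike vector -/

namespace Minkowski

variable {E : Type*} [NormedAddCommGroup E] [InnerProductSpace ℝ E]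

/-- A spacelike vector is made orthogonal to the time axis by a linear isometric involution, the
negative of the reflection in a suitable timelike vector. -/
lemma exists_boost {o : ℝ × E} (ho : 0 < form E o o) :
    ∃ σ : ℝ × E →ₗ[ℝ] ℝ × E, (∀ x, σ (σ x) = x) ∧ (∀ x y, form E (σ x) (σ y) = form E x y) ∧
      (∀ x, IsFuture x → IsFuture (σ x)) ∧ (σ o).1 = 0 := by
  have hn0 : 0 < ‖o.2‖ := by
    rw [form_self] at ho
    have : 0 < ‖o.2‖ ^ 2 := by nlinarith [sq_nonneg o.1]
    exact lt_of_le_of_ne (norm_nonneg _) fun h => by rw [← h] at this; simp at this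
  -- `n` is the sum of the time axis and of a parallel future timelike vector orthogonal to `o`
  set ρ := Real.sqrt (form E o o) with hρ
  have hρ0 : 0 < ρ := Real.sqrt_pos.2 ho
  have hρ2 : ρ ^ 2 = ‖o.2‖ ^ 2 - o.1 ^ 2 := by rw [hρ, Real.sq_sqrt ho.le, form_self]
  set n : ℝ × E := (‖o.2‖ + ρ, (o.1 / ‖o.2‖) • o.2) with hn
  have hnn : form E n n = -(2 * ρ * (‖o.2‖ + ρ)) := by
    rw [form_self, hn]
    simp only
    rw [norm_smul, mul_pow, Real.norm_eq_abs, sq_abs, div_pow, div_mul_cancel₀ _ (by positivity)]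
    linear_combination hρ2
  have hon : form E o n = -(o.1 * ρ) := by
    rw [form_apply, hn]
    simp only
    rw [real_inner_smul_right, real_inner_self_eq_norm_sq]
    field_simp
    ring
  have hneg : form E n n < 0 := by
    have : 0 < 2 * ρ * (‖o.2‖ + ρ) := by positivity
    rw [hnn]; linarith
  have hne : form E n n ≠ 0 := hneg.ne
  have hn1 : 0 < n.1 := by positivity
  let σ : ℝ × E →ₗ[ℝ] ℝ × E :=
    -LinearMap.id + (2 / form E n n) • ((form E).flip n).smulRight n
  have hσ : ∀ x, σ x = -x + (2 / form E n n * form E x n) • n := fun x => by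
    simp [σ, smul_smul]
  have hσn : ∀ x, form E (σ x) n = form E x n := fun x => by
    rw [hσ]
    simp only [map_add, map_neg, map_smul, LinearMap.add_apply, LinearMap.neg_apply,
      LinearMap.smul_apply, smul_eq_mul]
    field_simp
    ring
  have hiso : ∀ x y, form E (σ x) (σ y) = form E x y := fun x y => by
    conv_lhs => rw [hσ y, map_add, map_neg, map_smul, hσn, hσ x]
    simp only [map_add, map_neg, map_smul, LinearMap.add_apply, LinearMap.neg_apply,
      LinearMap.smul_apply, smul_eq_mul]
    rw [form_comm n y]
    ring
  refine ⟨σ, fun x => ?_, hiso, fun x hx => ?_, ?_⟩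
  · rw [hσ (σ x), hσn, hσ x]
    abel
  · refine isFuture_of_form_neg (y := n) (by rw [hiso]; exact hx.1) ⟨hneg.le, hn1⟩ ?_
    rw [hσn]
    exact hx.form_timelike_neg hneg hn1
  · rw [hσ, Prod.fst_add, Prod.fst_neg, Prod.smul_fst, smul_eq_mul, hon, hnn, hn]
    field_simp
    ring

/-- The orthogonal complement of a spacelike vector `o` is a Minkowski space of one dimension
less: `Φ` is the orthogonal projection onto it and `ρ` its inclusion. -/
lemma exists_projection [FiniteDimensional ℝ E] {N : ℕ} (hE : Module.finrank ℝ E = N + 1)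
    {o : ℝ × E} (ho : 0 < form E o o) :
    ∃ (Φ : ℝ × E →ₗ[ℝ] ℝ × EuclideanSpace ℝ (Fin N))
      (ρ : ℝ × EuclideanSpace ℝ (Fin N) →ₗ[ℝ] ℝ × E),
      (∀ x y, form E (ρ x) (ρ y) = form _ x y) ∧ (∀ x, ρ (Φ x) - x ∈ Submodule.span ℝ {o}) ∧
      (∀ x, IsFuture x → IsFuture (Φ x)) ∧ Φ o = 0 := by
  obtain ⟨σ, hσσ, hiso, hfut, hσo⟩ := exists_boost ho
  set u := (σ o).2 with hu
  have hσou : σ o = (0, u) := Prod.ext hσo rfl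
  have hu0 : u ≠ 0 := by
    intro h0
    have := hiso o o
    rw [hσou, h0, ← Prod.zero_eq_mk, map_zero] at this
    exact ho.ne this
  have hfr : Module.finrank ℝ (ℝ ∙ u)ᗮ = N := by
    have h1 := Submodule.finrank_add_finrank_orthogonal (ℝ ∙ u)
    rw [finrank_span_singleton hu0] at h1
    omega
  let ι : (ℝ ∙ u)ᗮ ≃ₗᵢ[ℝ] EuclideanSpace ℝ (Fin N) :=
    ((stdOrthonormalBasis ℝ (ℝ ∙ u)ᗮ).reindex (finCongr hfr)).repr
  let pr : E →ₗ[ℝ] (ℝ ∙ u)ᗮ := ((ℝ ∙ u)ᗮ.orthogonalProjectionOnto).toLinearMap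
  let Φ : ℝ × E →ₗ[ℝ] ℝ × EuclideanSpace ℝ (Fin N) :=
    (LinearMap.prodMap LinearMap.id (ι.toLinearEquiv.toLinearMap ∘ₗ pr)) ∘ₗ σ
  let ρ : ℝ × EuclideanSpace ℝ (Fin N) →ₗ[ℝ] ℝ × E :=
    σ ∘ₗ (LinearMap.prodMap LinearMap.id
      ((ℝ ∙ u)ᗮ.subtype ∘ₗ ι.symm.toLinearEquiv.toLinearMap))
  have hΦ : ∀ x, Φ x = ((σ x).1, ι (pr (σ x).2)) := fun x => rfl
  have hρ : ∀ y, ρ y = σ (y.1, (ι.symm y.2 : E)) := fun y => rfl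
  refine ⟨Φ, ρ, fun x y => ?_, fun x => ?_, fun x hx => ?_, ?_⟩
  · rw [hρ, hρ, hiso, form_apply, form_apply]
    simp only
    rw [← Submodule.coe_inner, ι.symm.inner_map_map]
  · rw [hρ, hΦ]
    simp only [LinearIsometryEquiv.symm_apply_apply]
    have h1 : (σ x).2 - (pr (σ x).2 : E) ∈ ((ℝ ∙ u)ᗮ)ᗮ :=
      (ℝ ∙ u)ᗮ.sub_starProjection_mem_orthogonal _
    rw [Submodule.orthogonal_orthogonal, Submodule.mem_span_singleton] at h1
    obtain ⟨c, hc⟩ := h1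
    rw [Submodule.mem_span_singleton]
    refine ⟨-c, ?_⟩
    have h2 : ((σ x).1, (pr (σ x).2 : E)) = σ x - c • σ o := by
      rw [hσou]
      ext
      · simp
      · simp [hc]
    rw [h2, map_sub, map_smul, hσσ, hσσ]
    module
  · have h1 := hfut x hx
    rw [hΦ]
    refine ⟨?_, h1.2⟩
    have h2 := h1.norm_le
    have h3 : ‖pr (σ x).2‖ ≤ ‖(σ x).2‖ := (ℝ ∙ u)ᗮ.norm_orthogonalProjectionOnto_apply_le _
    rw [form_self]
    simp only [LinearIsometryEquiv.norm_map]
    have h4 : ‖pr (σ x).2‖ ^ 2 ≤ (σ x).1 ^ 2 := by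
      gcongr
      exact h3.trans h2
    linarith
  · rw [hΦ, hσou]
    have h1 : pr u = 0 :=
      (ℝ ∙ u)ᗮ.orthogonalProjectionOnto_apply_of_mem_orthogonal
        (Submodule.le_orthogonal_orthogonal _ (Submodule.mem_span_singleton_self u))
    simp [h1]

end Minkowski

/-! ### Scribed cyclic polytopes -/

lemma sq_le_of_nonneg_span {V : Type*} [AddCommGroup V] [Module ℝ V] (B : LinearMap.BilinForm ℝ V)
    (hB : ∀ x y, B x y = B y x) {x y : V} (hx : 0 < B x x)
    (h : ∀ a b : ℝ, 0 ≤ B (a • x + b • y) (a • x + b • y)) : B x y ^ 2 ≤ B x x * B y y := by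
  have h1 := h (-B x y) (B x x)
  simp only [map_add, map_smul, LinearMap.add_apply, LinearMap.smul_apply, smul_eq_mul] at h1
  rw [hB y x] at h1
  have h2 : 0 ≤ B x x * (B x x * B y y - B x y ^ 2) := by nlinarith
  have := nonneg_of_mul_nonneg_right h2 hx
  linarith

namespace SphericalPolytope.FaceModel

variable {d n m : ℕ} {Q : SphericalPolytope d}

/-- For `k ≥ 2`, projecting along the vertices in `O` turns the pairs of consecutive vertices of a
`k`-scribed cyclic polytope into a configuration as in `exists_bound_pairs`. -/
theorem false_of_projection (h : 2 * m + 1 ≤ n) {t : Fin n → ℝ} (ht : StrictMono t)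
    (R : FaceModel Q n (IsGaleFace d t)) {k : ℕ} (hk : 2 ≤ k) (hkd : k < d)
    (hQ : Q.IsScribed k) {O : Finset (Fin n)} (hO : O ⊆ {apex h}) {e : ℕ} (he : 2 ≤ e)
    (hd : O.card + 2 * e = d) (hdn : d < n) (hem : e ≤ m) {E : Type*} [NormedAddCommGroup E]
    [InnerProductSpace ℝ E]
    (Φ : ℝ × EuclideanSpace ℝ (Fin d) →ₗ[ℝ] ℝ × E) (ρ : ℝ × E →ₗ[ℝ] ℝ × EuclideanSpace ℝ (Fin d))
    (hρ : ∀ x y, form _ (ρ x) (ρ y) = form E x y)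
    (hΦρ : ∀ x, ρ (Φ (toMinkowski d x)) - toMinkowski d x ∈
      (Submodule.span ℝ (R.vert '' O)).map (toMinkowski d).toLinearMap)
    (hΦ : ∀ x, IsFuture x → IsFuture (Φ x)) (hΦO : ∀ i ∈ O, Φ (toMinkowski d (R.vert i)) = 0)
    (hbound : ∀ v : Fin m × Bool → ℝ × E, (∀ p, 0 < form E (v p) (v p)) →
      (∀ p q, form E (v p) (v q) ^ 2 ≤ form E (v p) (v p) * form E (v q) (v q)) →
      (∀ J : Finset (Fin m), J.card = e → ∃ α : Fin m × Bool → ℝ, (∀ i, 0 ≤ α i) ∧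
        IsFuture (∑ i ∈ J, ∑ b, α (i, b) • v (i, b))) →
      (∀ J : Finset (Fin m), J.card = e → ∃ h : ℝ × E →ₗ[ℝ] ℝ,
        (∀ i ∈ J, ∀ b, h (v (i, b)) = 0) ∧ ∀ i ∉ J, ∀ b, 0 < h (v (i, b))) → False) :
    False := by
  classical
  have hOcard : O.card ≤ 1 := (Finset.card_le_card hO).trans (by simp)
  have hOdisj : ∀ J : Finset (Fin m), Disjoint O (pairSet h J) := fun J => by
    rw [Finset.disjoint_left]
    intro i hi
    rw [Finset.mem_singleton.1 (hO hi)]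
    exact apex_notMem_pairSet h J
  have hgood : ∀ J : Finset (Fin m), J.card = e → ∀ S ⊆ O ∪ pairSet h J, IsGaleFace d t S :=
    fun J hJ S hS => isGaleFace_of_subset h ht hO (by rw [hJ, hd]) hS
  have hcard : ∀ J : Finset (Fin m), J.card = e → (O ∪ pairSet h J).card = d := fun J hJ => by
    rw [Finset.card_union_of_disjoint (hOdisj J), card_pairSet, hJ, hd]
  have hout : ∀ J : Finset (Fin m), J.card = e → ∃ o, o ∉ O ∪ pairSet h J := fun J hJ => by
    obtain ⟨o, -, ho⟩ := Finset.exists_mem_notMem_of_card_lt_card (s := O ∪ pairSet h J)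
      (t := Finset.univ) (by rw [hcard J hJ, Finset.card_univ, Fintype.card_fin]; exact hdn)
    exact ⟨o, ho⟩
  have hsup : ∀ p q : Fin m × Bool, ∃ J : Finset (Fin m), J.card = e ∧ p.1 ∈ J ∧ q.1 ∈ J := by
    intro p q
    obtain ⟨J, hJ, hJe⟩ := Finset.exists_superset_card_eq (s := {p.1, q.1}) (n := e)
      (Finset.card_le_two.trans he) (by rwa [Fintype.card_fin])
    exact ⟨J, hJe, hJ (by simp), hJ (by simp)⟩
  have hlift : ∀ x, ∃ y ∈ Submodule.span ℝ (R.vert '' O),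
      ρ (Φ (toMinkowski d x)) = toMinkowski d (x + y) := by
    intro x
    obtain ⟨y, hy, he⟩ := hΦρ x
    refine ⟨y, hy, ?_⟩
    rw [map_add, ← sub_eq_iff_eq_add']
    exact he.symm
  have hform : ∀ x, ∃ y ∈ Submodule.span ℝ (R.vert '' O),
      form E (Φ (toMinkowski d x)) (Φ (toMinkowski d x)) = lform d (x + y) (x + y) := by
    intro x
    obtain ⟨y, hy, he⟩ := hlift x
    exact ⟨y, hy, by rw [← hρ, he, lform_def]⟩
  set X : Fin m × Bool → LSpace d := fun p => R.vert (pairVertex h p) with hX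
  have hspan : ∀ S₀ : Finset (Fin n), ∀ y ∈ Submodule.span ℝ (R.vert '' O),
      y ∈ Submodule.span ℝ (R.vert '' (O ∪ S₀ : Finset (Fin n))) := fun S₀ y hy =>
    Submodule.span_mono (image_mono (by simp)) hy
  have hXspan : ∀ p, ∀ S₀ : Finset (Fin n), pairVertex h p ∈ S₀ →
      X p ∈ Submodule.span ℝ (R.vert '' (O ∪ S₀ : Finset (Fin n))) := fun p S₀ hp =>
    Submodule.subset_span ⟨_, by simp [hp], rfl⟩
  have hpsd : ∀ p q, ∀ a b : ℝ,
      0 ≤ form E (a • Φ (toMinkowski d (X p)) + b • Φ (toMinkowski d (X q)))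
        (a • Φ (toMinkowski d (X p)) + b • Φ (toMinkowski d (X q))) := by
    intro p q a b
    obtain ⟨J, hJ, hp, hq⟩ := hsup p q
    obtain ⟨o, ho⟩ := hout J hJ
    simp only [← map_smul, ← map_add]
    obtain ⟨y, hy, he⟩ := hform (a • X p + b • X q)
    rw [he]
    refine R.lform_nonneg (hgood J hJ) (hcard J hJ) ho hQ hk hkd
      (S₀ := O ∪ {pairVertex h p, pairVertex h q}) (Finset.union_subset_union_right ?_) ?_ ?_
    · intro i hi
      rcases Finset.mem_insert.1 hi with rfl | hi
      · exact (pairVertex_mem_pairSet h).2 hp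
      · rw [Finset.mem_singleton.1 hi]
        exact (pairVertex_mem_pairSet h).2 hq
    · have h1 := Finset.card_union_le O {pairVertex h p, pairVertex h q}
      have h2 := Finset.card_le_two (a := pairVertex h p) (b := pairVertex h q)
      omega
    · exact Submodule.add_mem _ (Submodule.add_mem _
        (Submodule.smul_mem _ _ (hXspan p _ (by simp)))
        (Submodule.smul_mem _ _ (hXspan q _ (by simp)))) (hspan _ y hy)
  have hpos : ∀ p, 0 < form E (Φ (toMinkowski d (X p))) (Φ (toMinkowski d (X p))) := by
    intro p
    refine lt_of_le_of_ne (by simpa using hpsd p p 1 0) fun h0 => ?_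
    obtain ⟨J, hJ, hp, -⟩ := hsup p p
    obtain ⟨o, ho⟩ := hout J hJ
    obtain ⟨y, hy, he⟩ := hform (X p)
    have hz := R.eq_zero_of_lform_eq_zero (hgood J hJ) (hcard J hJ) ho hQ hk hkd
      (S₀ := O ∪ {pairVertex h p}) (Finset.union_subset_union_right
        (Finset.singleton_subset_iff.2 ((pairVertex_mem_pairSet h).2 hp)))
      (by
        have h1 := Finset.card_union_le O {pairVertex h p}
        rw [Finset.card_singleton] at h1
        omega)
      (Submodule.add_mem _ (hXspan p _ (by simp)) (hspan _ y hy)) (by rw [← he, ← h0])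
    obtain ⟨f, -, -, hf0, hf1⟩ := R.exists_functional
      (hgood J hJ O Finset.subset_union_left)
    have hfy : f y = 0 := by
      have : Submodule.span ℝ (R.vert '' O) ≤ LinearMap.ker f := by
        rw [Submodule.span_le]
        rintro _ ⟨i, hi, rfl⟩
        exact hf0 i hi
      exact this hy
    have h1 := congrArg f hz
    rw [map_add, hfy, add_zero, map_zero] at h1
    refine (hf1 (pairVertex h p) (fun hmem => ?_)).ne h1
    exact pairVertex_ne_apex h p (Finset.mem_singleton.1 (hO hmem))
  refine hbound (fun p => Φ (toMinkowski d (X p))) hpos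
    (fun p q => sq_le_of_nonneg_span _ form_comm (hpos p) (hpsd p q)) (fun J hJ => ?_)
    (fun J hJ => ?_)
  · obtain ⟨o, ho⟩ := hout J hJ
    obtain ⟨c, hc, hfut⟩ := R.exists_future (hgood J hJ) (hcard J hJ) ho hQ hkd
    refine ⟨fun p => c (pairVertex h p), fun p => hc _, ?_⟩
    have h1 := hΦ _ hfut
    rw [Finset.sum_union (hOdisj J), map_add, map_add] at h1
    have h2 : Φ (toMinkowski d (∑ i ∈ O, c i • R.vert i)) = 0 := by
      rw [map_sum, map_sum]
      exact Finset.sum_eq_zero fun i hi => by rw [map_smul, map_smul, hΦO i hi, smul_zero]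
    rw [h2, zero_add, pairSet, Finset.sum_map, Finset.sum_product] at h1
    simp only [map_sum, map_smul] at h1
    exact h1
  · obtain ⟨f, -, -, hf0, hf1⟩ := R.exists_functional (hgood J hJ _ subset_rfl)
    have hval : ∀ p, -(f ((toMinkowski d).symm (ρ (Φ (toMinkowski d (X p)))))) = -f (X p) := by
      intro p
      obtain ⟨y, hy, he⟩ := hlift (X p)
      have hfy : f y = 0 := by
        have : Submodule.span ℝ (R.vert '' O) ≤ LinearMap.ker f := by
          rw [Submodule.span_le]
          rintro _ ⟨i, hi, rfl⟩
          exact hf0 i (Finset.mem_union_left _ hi)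
        exact this hy
      rw [he, LinearEquiv.symm_apply_apply, map_add, hfy, add_zero]
    refine ⟨-(f ∘ₗ (toMinkowski d).symm.toLinearMap ∘ₗ ρ), fun i hi b => ?_, fun i hi b => ?_⟩
    · refine (hval (i, b)).trans ?_
      rw [hX, hf0 _ (Finset.mem_union_right _ ((pairVertex_mem_pairSet h).2 hi)), neg_zero]
    · refine lt_of_lt_of_eq ?_ (hval (i, b)).symm
      refine neg_pos.2 (hf1 _ fun hmem => ?_)
      rcases Finset.mem_union.1 hmem with h1 | h1
      · exact pairVertex_ne_apex h _ (Finset.mem_singleton.1 (hO h1))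
      · exact hi ((pairVertex_mem_pairSet h).1 h1)

end SphericalPolytope.FaceModel

open SphericalPolytope FaceModel

/-- The number of vertices of a cyclic polytope with tangent edges is bounded. -/
theorem exists_bound_of_one_scribed {d : ℕ} (hd : 3 < d) :
    ∃ N : ℕ, ∀ n, N ≤ n → ∀ t : Fin n → ℝ, StrictMono t → ∀ Q : SphericalPolytope d,
      FaceModel Q n (IsGaleFace d t) → Q.IsScribed 1 → False := by
  refine ⟨2 * (d + 5) + 1, fun n hn t ht Q R hQ => ?_⟩
  have h1 := R.card_le_of_tangent_edges hQ (fun i : Fin (d + 5) => pairVertex hn (i, false))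
    (fun i j he => by simpa using pairVertex_injective hn he) (fun i j => by
      classical
      obtain ⟨J, hJ, hJe⟩ := Finset.exists_superset_card_eq (s := {i, j}) (n := d / 2)
        (Finset.card_le_two.trans (by omega)) (by rw [Fintype.card_fin]; omega)
      -- for odd `d` the first vertex completes the pairs to a facet
      obtain ⟨O, hO, hOc⟩ := Finset.exists_subset_card_eq (s := {apex hn}) (n := d % 2)
        (by rw [Finset.card_singleton]; omega)
      have hc : O.card + 2 * J.card = d := by omega
      have hcard : (O ∪ pairSet hn J).card ≤ d := by
        refine (Finset.card_union_le _ _).trans ?_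
        rw [card_pairSet]; omega
      have hdisj : Disjoint O (pairSet hn J) := by
        rw [Finset.disjoint_left]
        intro i hi
        rw [Finset.mem_singleton.1 (hO hi)]
        exact apex_notMem_pairSet hn J
      refine ⟨O ∪ pairSet hn J,
        Finset.mem_union_right _ ((pairVertex_mem_pairSet hn).2 (hJ (by simp))),
        Finset.mem_union_right _ ((pairVertex_mem_pairSet hn).2 (hJ (by simp))),
        fun S hS => isGaleFace_of_subset hn ht hO hc hS, ?_, ?_⟩
      · rw [Finset.card_union_of_disjoint hdisj, card_pairSet, hc]
      · obtain ⟨o, -, ho⟩ := Finset.exists_mem_notMem_of_card_lt_card (s := O ∪ pairSet hn J)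
          (t := Finset.univ) (by rw [Finset.card_univ, Fintype.card_fin]; omega)
        exact ⟨o, ho⟩)
  omega

/-- The number of vertices of a `k`-scribed cyclic polytope is bounded for `k ≥ 2`. -/
theorem exists_bound_of_scribed {d k : ℕ} (hd : 3 < d) (hk : 2 ≤ k) (hkd : k < d) :
    ∃ N : ℕ, ∀ n, N ≤ n → ∀ t : Fin n → ℝ, StrictMono t → ∀ Q : SphericalPolytope d,
      FaceModel Q n (IsGaleFace d t) → Q.IsScribed k → False := by
  classical
  rcases Nat.even_or_odd' d with ⟨e, hde | hde⟩
  · obtain ⟨M, heM, hM⟩ := exists_bound_pairs (E := EuclideanSpace ℝ (Fin d)) (e := e) (by omega)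
      (by rw [finrank_euclideanSpace_fin, hde])
    refine ⟨2 * M + 1, fun n hn t ht Q R hQ => ?_⟩
    exact R.false_of_projection hn ht hk hkd hQ (O := ∅) (Finset.empty_subset _) (e := e) (by omega)
      (by simp [hde]) (by omega) heM LinearMap.id LinearMap.id (fun _ _ => rfl) (fun x => by simp)
      (fun _ hx => hx) (by simp) hM
  · obtain ⟨M, heM, hM⟩ := exists_bound_pairs (E := EuclideanSpace ℝ (Fin (2 * e))) (e := e)
      (by omega) (by rw [finrank_euclideanSpace_fin])
    refine ⟨2 * M + 2, fun n hn t ht Q R hQ => ?_⟩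
    have hn' : 2 * M + 1 ≤ n := by omega
    -- the first vertex is spacelike, so it can be projected away
    have ho : 0 < lform d (R.vert (apex hn')) (R.vert (apex hn')) := by
      obtain ⟨J, -, hJe⟩ := Finset.exists_subset_card_eq (s := (Finset.univ : Finset (Fin M)))
        (n := e) (by rwa [Finset.card_univ, Fintype.card_fin])
      have hgood : ∀ S ⊆ {apex hn'} ∪ pairSet hn' J, IsGaleFace d t S := fun S hS =>
        isGaleFace_of_subset hn' ht subset_rfl (by rw [Finset.card_singleton, hJe]; omega) hS
      have hcard : ({apex hn'} ∪ pairSet hn' J).card = d := by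
        rw [Finset.card_union_of_disjoint
          (Finset.disjoint_singleton_left.2 (apex_notMem_pairSet hn' J)), card_pairSet, hJe,
          Finset.card_singleton]
        omega
      obtain ⟨o, -, ho⟩ := Finset.exists_mem_notMem_of_card_lt_card
        (s := {apex hn'} ∪ pairSet hn' J) (t := Finset.univ)
        (by rw [Finset.card_univ, Fintype.card_fin]; omega)
      have hmem : R.vert (apex hn') ∈
          Submodule.span ℝ (R.vert '' ({apex hn'} : Finset (Fin n))) :=
        Submodule.subset_span ⟨_, by simp, rfl⟩
      refine lt_of_le_of_ne (R.lform_nonneg hgood hcard ho hQ hk hkd (S₀ := {apex hn'})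
        Finset.subset_union_left (by simp) hmem) fun h0 => ?_
      have hz := R.eq_zero_of_lform_eq_zero hgood hcard ho hQ hk hkd (S₀ := {apex hn'})
        Finset.subset_union_left (by rw [Finset.card_singleton]; omega) hmem h0.symm
      have h1 := (R.vert_mem (apex hn')).2
      rw [hz, mem_sphere_zero_iff_norm, norm_zero] at h1
      exact zero_ne_one h1
    obtain ⟨Φ, ρ, hρ, hΦρ, hΦ, hΦo⟩ := exists_projection (N := 2 * e)
      (by rw [finrank_euclideanSpace_fin, hde]) (o := toMinkowski d (R.vert (apex hn'))) ho
    refine R.false_of_projection hn' ht hk hkd hQ (O := {apex hn'}) subset_rfl (e := e) (by omega)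
      (by rw [Finset.card_singleton, hde]; ring) (by omega) heM Φ ρ hρ (fun x => ?_) hΦ ?_ hM
    · rw [Submodule.map_span]
      simpa using hΦρ (toMinkowski d x)
    · intro i hi
      rw [Finset.mem_singleton.1 hi, hΦo]

end

theorem theorem1p2 (d k : ℕ) (hd : 3 < d) (hk : 1 ≤ k) (hkd : k ≤ d - 1) :
    ∃ N : ℕ, ∀ n : ℕ, N ≤ n → ∀ P : Set (EuclideanSpace ℝ (Fin d)),
      IsCyclicPolytope d n P → ¬ IsScribable k P := by
  obtain ⟨N, hN⟩ : ∃ N : ℕ, ∀ n, N ≤ n → ∀ t : Fin n → ℝ, StrictMono t →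
      ∀ Q : SphericalPolytope d, SphericalPolytope.FaceModel Q n (IsGaleFace d t) →
        Q.IsScribed k → False := by
    rcases hk.eq_or_lt with rfl | hk
    · exact exists_bound_of_one_scribed hd
    · exact exists_bound_of_scribed hd hk (by omega)
  refine ⟨N, ?_⟩
  rintro n hn P ⟨-, -, t, ht, ⟨Θ⟩⟩ ⟨Q, ⟨Ψ⟩, hQ⟩
  obtain ⟨R⟩ := SphericalPolytope.nonempty_faceModel (Q := Q) (by omega) ht (Θ.symm.trans Ψ)
  exact hN n hn t ht Q R hQ
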